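/- Let $D=2n$, $J=\begin{pmatrix}0&I\\-I&0\end{pmatrix}$, and let $\Phi$ be a consistent one-step integrator on $\mathbb{R}^D$: for every smooth vector field $f$ the numerical solution $\Phi_{h,f}(x)$ satisfies $\Phi_{h,f}(x)=x+hf(x)+O(h^2)$ and, near $h=0$, depends smoothly on $h$, on $x$, and on the parameters of any smooth finite-parameter family of vector fields (for example, a consistent Runge–Kutta method). Let $\phi_{h,f}(x)$ denote the value at time $h$ of the solution of $\dot y=f(y)$, $y(0)=x$. The inverse modified differential equation (IMDE) of $\Phi$ and $f$ is the formal series $f_h=\sum_{k\ge 0}h^kf_k$ with smooth coefficients $f_k$ such that $\Phi_{h,f_h}(x)=\phi_{h,f}(x)$ as formal power series in $h$, that is, with $f_h^K=\sum_{k=0}^{K}h^kf_k$, $$\Phi_{h,f_h^K}(x)=\phi_{h,f}(x)+O(h^{K+2})\qquad\text{for all }x\in\mathbb{R}^D,\ K\ge 0 .$$ Say that $\Phi$ applied to $f$ preserves the symplectic form to order $r$ if $\Phi_{h,f}'(x)^{T}J\,\Phi_{h,f}'(x)=J+O(h^{r+1})$ for all $x$, where $'$ is the Jacobian in $x$. Call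 $\Phi$ symplectic if, applied to any Hamiltonian system $f=J^{-1}\nabla H$ with smooth $H:\mathbb{R}^D\to\mathbb{R}$, it preserves the symplectic form to every order, that is, $\Phi_{h,f}'(x)^TJ\Phi_{h,f}'(x)=J$ as formal power series in $h$ (in particular, this holds if the maps $\Phi_{h,f}$ are symplectic for all small $h$). 1. For every smooth $f$ the coefficients $f_0,f_1,\dots$ of the IMDE exist and are unique. 2. Let $\Phi$ be symplectic and let $f=J^{-1}\nabla H$ with $H$ smooth. Then every point of $\mathbb{R}^D$ has an open neighbourhood $U$ with smooth functions $H_k:U\to\mathbb{R}$, $k=0,1,2,\dots$, such that $f_k=J^{-1}\nabla H_k$ on $U$ for all $k$. 3. Let $\Phi$ be not symplectic. Then there is a $\hat k$, depending only on $\Phi$, such that $\Phi$ preserves the symplectic form to order $\hat k$ for all Hamiltonian systems with smooth Hamiltonian, but not to order $\hat k+1$ for at least one of them; and for every smooth $H$ for which $\Phi$ applied to $f=J^{-1}\nabla H$ does not preserve the symplectic form to order $\hat k+1$, the field $Jf_{\hat k}$ is not a potential field (not even locally: some point has no neighbourhood on which it is a gradient). Consequently, for such $H$ and every $K\ge\hat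 k$, the truncated IMDE field $f_h^K$, which a Neural ODE trained with $\Phi$ approximates, is not Hamiltonian for all sufficiently small $h\ne 0$: $Jf_h^K$ is not a potential field, not even locally. -/

import Mathlib

open scoped ContDiff Topology

noncomputable section

namespace IMDE

/-- The space `ℝ^D` with `D = 2 * n`, coordinates split into two blocks of length `n`. -/
abbrev PhaseSpace (n : ℕ) : Type := EuclideanSpace ℝ (Fin n ⊕ Fin n)

/-- The matrix `J = (0, I; -I, 0)`. -/
def J (n : ℕ) : Matrix (Fin n ⊕ Fin n) (Fin n ⊕ Fin n) ℝ :=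
  Matrix.fromBlocks 0 1 (-1) 0

/-- A matrix acting on a vector of the phase space. -/
def act {n : ℕ} (A : Matrix (Fin n ⊕ Fin n) (Fin n ⊕ Fin n) ℝ) (v : PhaseSpace n) :
    PhaseSpace n :=
  WithLp.toLp 2 (A.mulVec v.ofLp)

/-- The vector field `J⁻¹ ∇H` of the Hamiltonian system with Hamiltonian function `H`. -/
def hamiltonianField {n : ℕ} (H : PhaseSpace n → ℝ) (y : PhaseSpace n) : PhaseSpace n :=
  act (J n)⁻¹ (gradient H y)

/-- The Jacobian matrix `∂ g_i / ∂ x_j` of `g` at `x`. -/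
def jacobian {n : ℕ} (g : PhaseSpace n → PhaseSpace n) (x : PhaseSpace n) :
    Matrix (Fin n ⊕ Fin n) (Fin n ⊕ Fin n) ℝ :=
  Matrix.of fun i j => fderiv ℝ g x (EuclideanSpace.single j 1) i

/-- `g` is a gradient near every point. (On the whole space, a gradient field has this property;
so a field without it is not a potential field, and not even locally one.) -/
def IsLocallyPotential {n : ℕ} (g : PhaseSpace n → PhaseSpace n) : Prop :=
  ∀ x, ∃ U : Set (PhaseSpace n), IsOpen U ∧ x ∈ U ∧
    ∃ V : PhaseSpace n → ℝ, DifferentiableOn ℝ V U ∧ ∀ y ∈ U, g y = gradient V y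

/-- A consistent one-step integrator `Φ`: it assigns to a vector field `f`, a step size `h` and an
initial value `x` the numerical solution `Φ_{h,f}(x) = step f h x`. Nothing is asked for vector
fields that are not smooth or for step sizes away from `0` (implicit methods are only solvable for
small `h`). Near `h = 0` the numerical solution depends smoothly on the initial value, on the step
size and on the parameters of a smooth family of vector fields; hence
`Φ_{h,f}(x) = x + h d_{1,f}(x) + h² d_{2,f}(x) + ⋯` with smooth coefficients that depend
smoothly on the vector field. Consistency is `d_{1,f} = f`. -/
structure Integrator (n : ℕ) where
  step : (PhaseSpace n → PhaseSpace n) → ℝ → PhaseSpace n → PhaseSpace n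
  smooth_step : ∀ (m : ℕ) (g : EuclideanSpace ℝ (Fin m) → PhaseSpace n → PhaseSpace n),
    ContDiff ℝ ∞ (fun q : EuclideanSpace ℝ (Fin m) × PhaseSpace n => g q.1 q.2) →
    ∀ (p : EuclideanSpace ℝ (Fin m)) (x : PhaseSpace n),
      ContDiffAt ℝ ∞
        (fun q : EuclideanSpace ℝ (Fin m) × ℝ × PhaseSpace n => step (g q.1) q.2.1 q.2.2)
        (p, 0, x)
  step_zero : ∀ f : PhaseSpace n → PhaseSpace n, ContDiff ℝ ∞ f → ∀ x, step f 0 x = x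
  consistent : ∀ f : PhaseSpace n → PhaseSpace n, ContDiff ℝ ∞ f → ∀ x,
    HasDerivAt (fun h => step f h x) (f x) 0

/-- The truncation `f_h^K = ∑_{k ≤ K} h^k f_k`. -/
def truncation {n : ℕ} (F : ℕ → PhaseSpace n → PhaseSpace n) (K : ℕ) (h : ℝ)
    (y : PhaseSpace n) : PhaseSpace n :=
  ∑ k ∈ Finset.range (K + 1), h ^ k • F k y

/-- The smooth vector fields `F 0, F 1, …` are the coefficients of the inverse modified
differential equation of the integrator `Φ` and the system `y' = f(y)`: the expansions in powers
of `h` of `Φ_{h,f_h}(x)`, where `f_h = ∑ h^k F k`, and of the exact solution `y(h)` with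
`y(0) = x` coincide term by term. The terms up to `h^(K+1)` only involve `F 0, …, F K`, and their
equality is `Φ_{h,f_h^K}(x) = y(h) + O(h^(K+2))`. -/
def IsIMDE {n : ℕ} (Φ : Integrator n) (f : PhaseSpace n → PhaseSpace n)
    (F : ℕ → PhaseSpace n → PhaseSpace n) : Prop :=
  (∀ k, ContDiff ℝ ∞ (F k)) ∧
  ∀ (x : PhaseSpace n) (y : ℝ → PhaseSpace n),
    y 0 = x → (∀ᶠ t in 𝓝 (0 : ℝ), HasDerivAt y (f (y t)) t) →
    ∀ K : ℕ, (fun h : ℝ => Φ.step (truncation F K h) h x - y h) =O[𝓝 0] fun h => h ^ (K + 2)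

/-- Applied to the vector field `f`, the integrator preserves the symplectic form to order `r`:
`Φ_{h,f}'(x)ᵀ J Φ_{h,f}'(x) = J + O(h^(r+1))` for every `x`. -/
def PreservesForm {n : ℕ} (Φ : Integrator n) (f : PhaseSpace n → PhaseSpace n) (r : ℕ) : Prop :=
  ∀ (x : PhaseSpace n) (i j : Fin n ⊕ Fin n),
    (fun h : ℝ =>
      ((jacobian (Φ.step f h) x).transpose * J n * jacobian (Φ.step f h) x - J n) i j)
      =O[𝓝 0] fun h => h ^ (r + 1)

/-- The integrator is symplectic: whenever it is applied to a Hamiltonian system,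
`Φ_{h,f}'(x)ᵀ J Φ_{h,f}'(x) = J`, as an identity of formal power series in `h`
(so in particular if the maps `Φ_{h,f}` are symplectic for all small `h`). -/
def IsSymplectic {n : ℕ} (Φ : Integrator n) : Prop :=
  ∀ H : PhaseSpace n → ℝ, ContDiff ℝ ∞ H → ∀ r, PreservesForm Φ (hamiltonianField H) r

end IMDE

end

/-!
The germ at `h = 0` of a function `T (h, x)` that is smooth along the slice `h = 0` is studied
through its order of vanishing in `h`. For such functions, `T (h, x) = O(h ^ m)` for each `x`, the
same bound locally uniformly in `x`, and the vanishing at `h = 0` of the derivatives in `h` of order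
less than `m` are equivalent (`Vanishes.flat`, `Flat.of_isBigO`), and derivatives in `x` have at
least the same order (`Flat.dx`). So expansions in `h` may be differentiated in `x` and in
parameters.

Existence and uniqueness. By consistency, applied uniformly over a family of vector fields in which
`F j` has its own parameter, the term `h ^ j F j` of the vector field changes the numerical solution
by `h ^ (j + 1) F j (x) + O(h ^ (j + 2))` (`flat_numFlow_succ`). The exact solution has the Lie
series as its expansion, with smooth coefficients, so each coefficient `F j` is determined by the
preceding ones and is smooth (`Expands.exists_next`).

Symplecticity. Let `f` be Hamiltonian. The numerical solution for the first `j` terms of the inverse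
modified field satisfies the transport equation `∂u/∂h = u' f` to order `j`, and the pulled back
symplectic form then satisfies a transport equation too; as `f` leaves the symplectic form
`ω` invariant, the form is preserved to that order (`flat_pullback_sub`). No smooth dependence of
the flow on its initial value is needed. Stopping before the term `h ^ j F j` hence produces the
error `- h ^ (j + 1) L_{F j} ω` in the form (`isBigO_formDefect_add_lieForm`). On the other hand, if
the integrator preserves the form to order `j` on all Hamiltonian systems and `F 0, …, F (j - 1)`
are Hamiltonian, then the error of order `h ^ (j + 1)` for the Hamiltonian field
`∑ k < j, p ^ k F k` depends smoothly on `p`, so its leading coefficient is the same for `p = h` as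
for `p = 0`, that is, for `f` itself (`isBigO_formDefect_sub`). Therefore the form is preserved to
order `j + 1` along `f` if and only if `L_{F j} ω = 0` (`preservesForm_succ_iff`), which by
Poincaré's lemma means that `F j` is Hamiltonian. Both statements about symplecticity follow.
-/

namespace IMDE

noncomputable section

open Filter Asymptotics

set_option linter.unusedSectionVars false

/-! ### Functions of a step size, up to powers of the step size -/

section GermCalculus

variable {E F : Type*} [NormedAddCommGroup E] [NormedSpace ℝ E]
  [NormedAddCommGroup F] [NormedSpace ℝ F]

/-- `T (h, x)` is smooth at every point of the slice `h = 0`. Only the germ of `T` along this slice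
matters in what follows. -/
def GermSmooth (T : ℝ × E → F) : Prop := ∀ x, ContDiffAt ℝ ∞ T (0, x)

/-- The partial derivative of `T (h, x)` with respect to `h`. -/
def dh (T : ℝ × E → F) (q : ℝ × E) : F := fderiv ℝ T q (1, 0)

/-- The derivative of `T (h, x)` in `x` along the vector field `w`. -/
def dx (w : E → E) (T : ℝ × E → F) (q : ℝ × E) : F := fderiv ℝ T q (0, w q.2)

/-- The derivatives of `T (h, x)` in `h` of order less than `m` vanish at `h = 0`, for every `x`. -/
def Vanishes : ℕ → (ℝ × E → F) → Prop
  | 0, _ => True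
  | m + 1, T => (∀ x, T (0, x) = 0) ∧ Vanishes m (dh T)

/-- `T (h, x) = O(h ^ m)`, locally uniformly in `x`. -/
def Flat (m : ℕ) (T : ℝ × E → F) : Prop := ∀ x, T =O[𝓝 (0, x)] fun q => q.1 ^ m

/-- Two functions have the same germ along the slice `h = 0`. -/
def GermEq (S T : ℝ × E → F) : Prop := ∀ x, S =ᶠ[𝓝 (0, x)] T

lemma GermSmooth.fderiv {T : ℝ × E → F} (hT : GermSmooth T) : GermSmooth (fderiv ℝ T) :=
  fun x => (hT x).fderiv_right (m := ∞) (by simp)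

lemma GermSmooth.dh {T : ℝ × E → F} (hT : GermSmooth T) : GermSmooth (dh T) :=
  fun x => (hT.fderiv x).clm_apply contDiffAt_const

lemma GermSmooth.dx {T : ℝ × E → F} (hT : GermSmooth T) {w : E → E} (hw : ContDiff ℝ ∞ w) :
    GermSmooth (dx w T) :=
  fun x => (hT.fderiv x).clm_apply
    (contDiffAt_const.prodMk (hw.comp contDiff_snd).contDiffAt)

lemma GermSmooth.sub {S T : ℝ × E → F} (hS : GermSmooth S) (hT : GermSmooth T) :
    GermSmooth (fun q => S q - T q) := fun x => (hS x).sub (hT x)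

lemma GermSmooth.of_contDiff {T : ℝ × E → F} (hT : ContDiff ℝ ∞ T) : GermSmooth T :=
  fun _ => hT.contDiffAt

lemma GermSmooth.contDiff_slice {T : ℝ × E → F} (hT : GermSmooth T) :
    ContDiff ℝ ∞ fun x => T (0, x) :=
  contDiff_iff_contDiffAt.2 fun x =>
    (hT x).comp x (contDiff_const.prodMk contDiff_id).contDiffAt

lemma GermSmooth.eventually {T : ℝ × E → F} (hT : GermSmooth T) (x : E) :
    ∀ᶠ q in 𝓝 ((0 : ℝ), x), ContDiffAt ℝ 2 T q :=
  ((hT x).of_le (m := 2) (by norm_cast)).eventually (by simp)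

lemma GermSmooth.eventually_differentiableAt {T : ℝ × E → F} (hT : GermSmooth T) (x : E) :
    ∀ᶠ q in 𝓝 ((0 : ℝ), x), DifferentiableAt ℝ T q :=
  (hT.eventually x).mono fun _ hq => hq.differentiableAt (by simp)

lemma GermEq.dh {S T : ℝ × E → F} (h : GermEq S T) : GermEq (dh S) (dh T) :=
  fun x => ((h x).fderiv (𝕜 := ℝ)).mono fun _ hq => congrArg (fun L => L ((1 : ℝ), (0 : E))) hq

lemma Vanishes.congr {m : ℕ} {S T : ℝ × E → F} (hS : Vanishes m S) (h : GermEq S T) :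
    Vanishes m T := by
  induction m generalizing S T with
  | zero => trivial
  | succ m ih => exact ⟨fun x => (h x).self_of_nhds ▸ hS.1 x, ih hS.2 h.dh⟩

lemma Flat.congr {m : ℕ} {S T : ℝ × E → F} (hS : Flat m S) (h : GermEq S T) : Flat m T :=
  fun x => (hS x).congr' (h x) EventuallyEq.rfl

/-- Integration of `O(h ^ m)` in `h` gains one order. -/
lemma isBigO_pow_succ_of_hasDerivAt {T T' : ℝ × E → F} {m : ℕ} {x : E}
    (hd : ∀ᶠ q in 𝓝 ((0 : ℝ), x), HasDerivAt (fun h => T (h, q.2)) (T' q) q.1)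
    (h0 : ∀ z, T (0, z) = 0) (hT' : T' =O[𝓝 (0, x)] fun q => q.1 ^ m) :
    T =O[𝓝 (0, x)] fun q => q.1 ^ (m + 1) := by
  obtain ⟨c, hc⟩ := hT'.bound
  obtain ⟨ε, hε, hball⟩ := Metric.eventually_nhds_iff_ball.1 (hd.and hc)
  refine IsBigO.of_bound c ?_
  filter_upwards [Metric.ball_mem_nhds ((0 : ℝ), x) hε] with q hq
  have hmem : ∀ t ∈ Metric.closedBall (0 : ℝ) |q.1|, (t, q.2) ∈ Metric.ball ((0 : ℝ), x) ε := by
    intro t ht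
    simp only [Metric.mem_closedBall, dist_zero_right, Real.norm_eq_abs] at ht
    simp only [Metric.mem_ball, Prod.dist_eq, dist_zero_right, Real.norm_eq_abs,
      sup_lt_iff] at hq ⊢
    exact ⟨ht.trans_lt hq.1, hq.2⟩
  have hc0 : 0 ≤ c * |q.1| ^ m := by
    have := (hball q hq).2
    rw [norm_pow, Real.norm_eq_abs] at this
    exact (norm_nonneg _).trans this
  have key := (convex_closedBall (0 : ℝ) |q.1|).norm_image_sub_le_of_norm_hasDerivWithin_le
    (f := fun h => T (h, q.2)) (f' := fun t => T' (t, q.2)) (C := c * |q.1| ^ m) (x := 0) (y := q.1)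
    (fun t ht => (hball _ (hmem t ht)).1.hasDerivWithinAt)
    (fun t ht => ?_) (by simp) (by simp)
  · simp only [h0, sub_zero] at key
    rw [norm_pow, pow_succ, ← mul_assoc]
    exact key
  · have h1 := (hball _ (hmem t ht)).2
    simp only [Metric.mem_closedBall, dist_zero_right] at ht
    rw [norm_pow] at h1
    -- A negative `c` is only possible where the bound itself vanishes.
    rcases le_or_gt 0 c with hcc | hcc
    · exact h1.trans (by gcongr)
    · have h2 : 0 ≤ c * ‖t‖ ^ m := (norm_nonneg _).trans h1
      have h3 : ‖t‖ ^ m = 0 := le_antisymm (by nlinarith) (by positivity)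
      rw [h3, mul_zero] at h1
      exact h1.trans hc0

lemma hasDerivAt_dh {T : ℝ × E → F} {q : ℝ × E} (hT : DifferentiableAt ℝ T q) :
    HasDerivAt (fun h => T (h, q.2)) (dh T q) q.1 :=
  HasFDerivAt.comp_hasDerivAt (x := q.1) (f := fun h => (h, q.2)) (l := T)
    hT.hasFDerivAt ((hasDerivAt_id q.1).prodMk (hasDerivAt_const q.1 q.2))

lemma hasFDerivAt_slice {T : ℝ × E → F} {h : ℝ} {x : E} (hT : DifferentiableAt ℝ T (h, x)) :
    HasFDerivAt (fun z => T (h, z))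
      ((fderiv ℝ T (h, x)).comp (ContinuousLinearMap.inr ℝ ℝ E)) x :=
  HasFDerivAt.comp (f := fun z : E => (h, z)) x hT.hasFDerivAt (hasFDerivAt_prodMk_right h x)

lemma Vanishes.flat {m : ℕ} {T : ℝ × E → F} (hv : Vanishes m T) (hT : GermSmooth T) :
    Flat m T := by
  induction m generalizing T with
  | zero =>
    intro x
    simpa using ((hT x).continuousAt.isBigO_one ℝ)
  | succ m ih =>
    exact fun x => isBigO_pow_succ_of_hasDerivAt
      ((hT.eventually_differentiableAt x).mono fun q hq => hasDerivAt_dh hq) hv.1 (ih hv.2 hT.dh x)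

lemma pow_isBigO_pow {m k : ℕ} (hk : k ≤ m) :
    (fun h : ℝ => h ^ m) =O[𝓝 0] fun h => h ^ k := by
  obtain ⟨i, rfl⟩ := Nat.exists_eq_add_of_le hk
  have h1 : (fun h : ℝ => h ^ i) =O[𝓝 0] fun _ => (1 : ℝ) :=
    (continuous_pow i).continuousAt.isBigO_one ℝ
  simpa [pow_add] using (isBigO_refl (fun h : ℝ => h ^ k) (𝓝 0)).mul h1

lemma tendsto_mk_nhds_zero (x : E) :
    Tendsto (fun h : ℝ => (h, x)) (𝓝 0) (𝓝 (0, x)) :=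
  (Continuous.prodMk continuous_id continuous_const).tendsto' _ _ rfl

lemma Flat.isBigO {m : ℕ} {T : ℝ × E → F} (hT : Flat m T) (x : E) :
    (fun h => T (h, x)) =O[𝓝 0] fun h => h ^ m :=
  (hT x).comp_tendsto (tendsto_mk_nhds_zero x)

lemma Flat.mono {m k : ℕ} {T : ℝ × E → F} (hT : Flat m T) (hk : k ≤ m) : Flat k T :=
  fun x => (hT x).trans <| by
    exact (pow_isBigO_pow hk).comp_tendsto (continuous_fst.tendsto' _ _ rfl)

lemma eq_zero_of_pow_smul_isBigO {m : ℕ} {c : F}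
    (h : (fun h : ℝ => h ^ m • c) =O[𝓝 0] fun h => h ^ (m + 1)) : c = 0 := by
  obtain ⟨C, hC⟩ := h.bound
  have h1 : ∀ᶠ t in 𝓝[≠] (0 : ℝ), ‖c‖ ≤ C * ‖t‖ := by
    filter_upwards [hC.filter_mono nhdsWithin_le_nhds, self_mem_nhdsWithin] with t ht h0
    rw [norm_smul, pow_succ, norm_mul, norm_pow, mul_left_comm] at ht
    exact le_of_mul_le_mul_left ht (pow_pos (norm_pos_iff.2 h0) m)
  have h2 : Tendsto (fun t : ℝ => C * ‖t‖) (𝓝[≠] 0) (𝓝 0) :=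
    ((continuous_const.mul continuous_norm).tendsto' (0 : ℝ) 0 (by simp)).mono_left
      nhdsWithin_le_nhds
  exact norm_le_zero_iff.1 (ge_of_tendsto h2 h1)

lemma differentiableAt_pow_smul (m : ℕ) {c : E → F} (hc : ContDiff ℝ ∞ c) (q : ℝ × E) :
    DifferentiableAt ℝ (fun q : ℝ × E => q.1 ^ m • c q.2) q := by
  have := hc.differentiable (by simp)
  fun_prop

lemma dh_pow_smul (m : ℕ) {c : E → F} (hc : ContDiff ℝ ∞ c) (q : ℝ × E) :
    dh (fun q : ℝ × E => q.1 ^ m • c q.2) q = (m * q.1 ^ (m - 1)) • c q.2 :=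
  (hasDerivAt_dh (differentiableAt_pow_smul m hc q)).unique
    ((hasDerivAt_pow m q.1).smul_const (c q.2))

lemma GermSmooth.pow_smul (m : ℕ) {c : E → F} (hc : ContDiff ℝ ∞ c) :
    GermSmooth fun q : ℝ × E => q.1 ^ m • c q.2 :=
  .of_contDiff (by fun_prop)

/-- The leading coefficient of a function vanishing to order `m`, a smooth function of `x`. -/
lemma Vanishes.exists_leading {m : ℕ} {T : ℝ × E → F} (hv : Vanishes m T) (hT : GermSmooth T) :
    ∃ c : E → F, ContDiff ℝ ∞ c ∧ Vanishes (m + 1) fun q => T q - q.1 ^ m • c q.2 := by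
  induction m generalizing T with
  | zero => exact ⟨fun x => T (0, x), hT.contDiff_slice, by simp, trivial⟩
  | succ m ih =>
    obtain ⟨c, hc, h1⟩ := ih hv.2 hT.dh
    have hc' : ContDiff ℝ ∞ fun x => ((m : ℝ) + 1)⁻¹ • c x := by fun_prop
    refine ⟨_, hc', fun x => by simp [hv.1 x], h1.congr fun x => ?_⟩
    filter_upwards [hT.eventually_differentiableAt x] with q hq
    have : dh (fun q : ℝ × E => T q - q.1 ^ (m + 1) • ((m : ℝ) + 1)⁻¹ • c q.2) q =
        dh T q - dh (fun q : ℝ × E => q.1 ^ (m + 1) • ((m : ℝ) + 1)⁻¹ • c q.2) q := by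
      simp only [dh]
      rw [fderiv_fun_sub hq (differentiableAt_pow_smul (m + 1) hc' q)]
      rfl
    rw [this, dh_pow_smul (m + 1) hc', smul_smul]
    congr 2
    push_cast
    have : (m : ℝ) + 1 ≠ 0 := by positivity
    field_simp

lemma Vanishes.of_isBigO {m : ℕ} {T : ℝ × E → F} (hT : GermSmooth T)
    (h : ∀ x, (fun h => T (h, x)) =O[𝓝 0] fun h => h ^ m) : Vanishes m T := by
  induction m generalizing T with
  | zero => trivial
  | succ m ih =>
    obtain ⟨c, hc, h1⟩ := (ih hT fun x =>
      (h x).trans (pow_isBigO_pow m.le_succ)).exists_leading hT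
    have h2 := h1.flat (hT.sub (.pow_smul m hc))
    have hc0 : ∀ x, c x = 0 := fun x => eq_zero_of_pow_smul_isBigO (m := m) <| by
      simpa using (h x).sub (h2.isBigO x)
    simpa [hc0] using h1

lemma Flat.of_isBigO {m : ℕ} {T : ℝ × E → F} (hT : GermSmooth T)
    (h : ∀ x, (fun h => T (h, x)) =O[𝓝 0] fun h => h ^ m) : Flat m T :=
  (Vanishes.of_isBigO hT h).flat hT

lemma Flat.vanishes {m : ℕ} {T : ℝ × E → F} (h : Flat m T) (hT : GermSmooth T) : Vanishes m T :=
  .of_isBigO hT h.isBigO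

lemma flat_succ_iff {m : ℕ} {T : ℝ × E → F} (hT : GermSmooth T) :
    Flat (m + 1) T ↔ (∀ x, T (0, x) = 0) ∧ Flat m (dh T) :=
  ⟨fun h => ⟨(h.vanishes hT).1, Vanishes.flat (h.vanishes hT).2 hT.dh⟩,
    fun h => Vanishes.flat ⟨h.1, h.2.vanishes hT.dh⟩ hT⟩

lemma Flat.exists_leading {m : ℕ} {T : ℝ × E → F} (h : Flat m T) (hT : GermSmooth T) :
    ∃ c : E → F, ContDiff ℝ ∞ c ∧ Flat (m + 1) fun q => T q - q.1 ^ m • c q.2 :=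
  let ⟨c, hc, h1⟩ := (h.vanishes hT).exists_leading hT
  ⟨c, hc, h1.flat (hT.sub (.pow_smul m hc))⟩

lemma Flat.add {m : ℕ} {S T : ℝ × E → F} (hS : Flat m S) (hT : Flat m T) :
    Flat m fun q => S q + T q := fun x => (hS x).add (hT x)

lemma Flat.sub {m : ℕ} {S T : ℝ × E → F} (hS : Flat m S) (hT : Flat m T) :
    Flat m fun q => S q - T q := fun x => (hS x).sub (hT x)

lemma flat_pow_smul (m : ℕ) {c : E → F} (hc : ContDiff ℝ ∞ c) :
    Flat m fun q : ℝ × E => q.1 ^ m • c q.2 := fun x => by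
  have h1 : (fun q : ℝ × E => c q.2) =O[𝓝 (0, x)] fun _ => (1 : ℝ) :=
    (hc.continuous.comp continuous_snd).continuousAt.isBigO_one ℝ
  simpa using (isBigO_refl (fun q : ℝ × E => q.1 ^ m) (𝓝 (0, x))).smul h1

/-- Differentiation in `x` does not change the order of vanishing in `h`: the derivatives in `h`
and in `x` commute. -/
lemma Flat.dx {m : ℕ} {T : ℝ × E → F} (h : Flat m T) (hT : GermSmooth T) {w : E → E}
    (hw : ContDiff ℝ ∞ w) : Flat m (dx w T) := by
  induction m generalizing T with
  | zero => exact Vanishes.flat (m := 0) trivial (hT.dx hw)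
  | succ m ih =>
    obtain ⟨h0, h1⟩ := (flat_succ_iff hT).1 h
    refine (flat_succ_iff (hT.dx hw)).2 ⟨fun x => ?_, (ih h1 hT.dh).congr fun x => ?_⟩
    · have h2 := hasFDerivAt_slice ((hT.eventually_differentiableAt x).self_of_nhds)
      simp only [h0] at h2
      exact congrArg (fun L => L (w x)) (h2.unique (hasFDerivAt_const 0 x))
    · filter_upwards [hT.eventually x] with q hq
      have hs : IsSymmSndFDerivAt ℝ T q := hq.isSymmSndFDerivAt (by simp)
      have h3 : HasFDerivAt (fderiv ℝ T) (fderiv ℝ (fderiv ℝ T) q) q :=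
        ((hq.fderiv_right (m := 1) (by norm_num)).differentiableAt (by simp)).hasFDerivAt
      have h4 := h3.clm_apply (hasFDerivAt_const ((1 : ℝ), (0 : E)) q)
      have h5 := h3.clm_apply ((hasFDerivAt_const (0 : ℝ) q).prodMk
        ((hw.differentiable (by simp) q.2).hasFDerivAt.comp q hasFDerivAt_snd))
      have h6 : IMDE.dx w (IMDE.dh T) q = _ := congrArg (fun L => L (0, w q.2)) h4.fderiv
      have h7 : IMDE.dh (IMDE.dx w T) q = _ := congrArg (fun L => L (1, 0)) h5.fderiv
      rw [h6, h7]
      simp [hs.eq (1, 0) (0, w q.2), Prod.mk_zero_zero]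

/-- A function of `(h, p, x)` that is `O(h ^ m)` varies with the parameter `p` by
`O(h ^ m * p)`. -/
lemma Flat.isBigO_sub_param {m : ℕ} {T : ℝ × (ℝ × E) → F} (h : Flat m T) (hT : GermSmooth T)
    {a : ℝ → ℝ} {b : ℝ → E} {x : E} (ha : Tendsto a (𝓝 0) (𝓝 0)) (hb : Tendsto b (𝓝 0) (𝓝 x)) :
    (fun h => T (h, (a h, b h)) - T (h, (0, b h))) =O[𝓝 0] fun h => h ^ m * a h := by
  have h1 := h.dx hT (w := fun _ => ((1 : ℝ), (0 : E))) contDiff_const ((0 : ℝ), x)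
  obtain ⟨c, hc⟩ := h1.bound
  obtain ⟨ε, hε, hball⟩ :=
    Metric.eventually_nhds_iff_ball.1 ((hT.eventually_differentiableAt (0, x)).and hc)
  refine IsBigO.of_bound c ?_
  have hb' : ∀ᶠ t in 𝓝 (0 : ℝ), (t, (a t, b t)) ∈ Metric.ball ((0 : ℝ), ((0 : ℝ), x)) ε :=
    (tendsto_id.prodMk_nhds (ha.prodMk_nhds hb)).eventually (Metric.ball_mem_nhds _ hε)
  filter_upwards [hb'] with t ht
  have hmem : ∀ p ∈ Metric.closedBall (0 : ℝ) |a t|,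
      (t, (p, b t)) ∈ Metric.ball ((0 : ℝ), ((0 : ℝ), x)) ε := by
    intro p hp
    simp only [Metric.mem_closedBall, dist_zero_right, Real.norm_eq_abs] at hp
    simp only [Metric.mem_ball, Prod.dist_eq, dist_zero_right, Real.norm_eq_abs,
      sup_lt_iff] at ht ⊢
    exact ⟨ht.1, hp.trans_lt ht.2.1, ht.2.2⟩
  have key := (convex_closedBall (0 : ℝ) |a t|).norm_image_sub_le_of_norm_hasDerivWithin_le
    (f := fun p => T (t, (p, b t)))
    (f' := fun p => IMDE.dx (fun _ => ((1 : ℝ), (0 : E))) T (t, (p, b t)))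
    (C := c * ‖t ^ m‖) (x := 0) (y := a t)
    (fun p hp => ?_) (fun p hp => (hball _ (hmem p hp)).2) (by simp) (by simp)
  · simpa [norm_mul, mul_assoc] using key
  · exact (HasFDerivAt.comp_hasDerivAt (x := p) (f := fun p => (t, (p, b t))) (l := T)
      (hball _ (hmem p hp)).1.hasFDerivAt ((hasDerivAt_const p t).prodMk
        ((hasDerivAt_id p).prodMk (hasDerivAt_const p (b t))))).hasDerivWithinAt

end GermCalculus

section Composition

variable {E E' F : Type*} [NormedAddCommGroup E] [NormedSpace ℝ E]
  [NormedAddCommGroup E'] [NormedSpace ℝ E'] [NormedAddCommGroup F] [NormedSpace ℝ F]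

lemma GermSmooth.comp {T : ℝ × E → F} (hT : GermSmooth T) {φ : ℝ × E' → ℝ × E}
    (hφ : ContDiff ℝ ∞ φ) (h0 : ∀ x, (φ (0, x)).1 = 0) : GermSmooth fun q => T (φ q) := fun x => by
  have h1 : φ (0, x) = (0, (φ (0, x)).2) := Prod.ext (h0 x) rfl
  refine ContDiffAt.comp (0, x) (g := T) ?_ hφ.contDiffAt
  rw [h1]
  exact hT _

lemma Flat.comp {m : ℕ} {T : ℝ × E → F} (hT : Flat m T) {φ : ℝ × E' → ℝ × E}
    (hφ : Continuous φ) (h0 : ∀ q, (φ q).1 = q.1) : Flat m fun q => T (φ q) := fun x => by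
  have h1 : φ (0, x) = (0, (φ (0, x)).2) := Prod.ext (h0 _) rfl
  have h2 := (hT (φ (0, x)).2).comp_tendsto (hφ.tendsto' (0, x) _ h1)
  simpa [Function.comp_def, h0] using h2

lemma dh_eq {T : ℝ × E → F} {q : ℝ × E} {v : F} (hT : DifferentiableAt ℝ T q)
    (h : HasDerivAt (fun t => T (t, q.2)) v q.1) : dh T q = v :=
  (hasDerivAt_dh hT).unique h

lemma dx_eq {T : ℝ × E → F} {q : ℝ × E} {w : E → E} {L : E →L[ℝ] F} (hT : DifferentiableAt ℝ T q)
    (h : HasFDerivAt (fun z => T (q.1, z)) L q.2) : dx w T q = L (w q.2) := by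
  rw [← (hasFDerivAt_slice hT).unique h]
  rfl

lemma dh_sub {S T : ℝ × E → F} {q : ℝ × E} (hS : DifferentiableAt ℝ S q)
    (hT : DifferentiableAt ℝ T q) : dh (fun q => S q - T q) q = dh S q - dh T q := by
  simp only [dh, fderiv_fun_sub hS hT]
  rfl

lemma dx_sub {S T : ℝ × E → F} {q : ℝ × E} {w : E → E} (hS : DifferentiableAt ℝ S q)
    (hT : DifferentiableAt ℝ T q) : dx w (fun q => S q - T q) q = dx w S q - dx w T q := by
  simp only [dx, fderiv_fun_sub hS hT]
  rfl

lemma isBigO_pow_succ_of_deriv {u u' : ℝ → F} {m : ℕ}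
    (hd : ∀ᶠ h in 𝓝 (0 : ℝ), HasDerivAt u (u' h) h) (h0 : u 0 = 0)
    (hu' : u' =O[𝓝 0] fun h => h ^ m) : u =O[𝓝 0] fun h => h ^ (m + 1) := by
  have hfst : Tendsto (Prod.fst : ℝ × ℝ → ℝ) (𝓝 (0, 0)) (𝓝 0) := continuous_fst.tendsto' _ _ rfl
  exact (isBigO_pow_succ_of_hasDerivAt (T := fun q : ℝ × ℝ => u q.1) (T' := fun q => u' q.1)
    (x := 0) (hfst.eventually hd) (fun _ => h0) (hu'.comp_tendsto hfst)).comp_tendsto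
    (tendsto_mk_nhds_zero 0)

end Composition

/-! ### Lie series of the exact flow -/

section LieSeries

variable {E F : Type*} [NormedAddCommGroup E] [NormedSpace ℝ E]
  [NormedAddCommGroup F] [NormedSpace ℝ F]

/-- The Lie derivative of the function `w` along the vector field `f`. -/
def lieDeriv (f : E → E) (w : E → F) (x : E) : F := fderiv ℝ w x (f x)

/-- The sum of the first `m` terms of the Lie series `∑ h ^ k / k! • L_f ^ k w`, which is the
expansion of `w` along the solutions of `y' = f(y)`. -/
def lieSeries (f : E → E) (w : E → F) (m : ℕ) (q : ℝ × E) : F :=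
  ∑ k ∈ Finset.range m, (q.1 ^ k / k.factorial) • (lieDeriv f)^[k] w q.2

lemma contDiff_lieDeriv {f : E → E} {w : E → F} (hf : ContDiff ℝ ∞ f) (hw : ContDiff ℝ ∞ w) :
    ContDiff ℝ ∞ (lieDeriv f w) :=
  (hw.fderiv_right (m := ∞) (by simp)).clm_apply hf

lemma contDiff_iterate_lieDeriv {f : E → E} {w : E → F} (hf : ContDiff ℝ ∞ f)
    (hw : ContDiff ℝ ∞ w) (k : ℕ) : ContDiff ℝ ∞ ((lieDeriv f)^[k] w) := by
  induction k with
  | zero => exact hw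
  | succ k ih =>
    rw [Function.iterate_succ_apply']
    exact contDiff_lieDeriv hf ih

lemma contDiff_lieSeries {f : E → E} {w : E → F} (hf : ContDiff ℝ ∞ f)
    (hw : ContDiff ℝ ∞ w) (m : ℕ) : ContDiff ℝ ∞ (lieSeries f w m) := by
  unfold lieSeries
  have := contDiff_iterate_lieDeriv hf hw
  fun_prop

lemma lieSeries_succ (f : E → E) (w : E → F) (m : ℕ) (q : ℝ × E) :
    lieSeries f w (m + 1) q =
      lieSeries f w m q + (q.1 ^ m / m.factorial) • (lieDeriv f)^[m] w q.2 :=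
  Finset.sum_range_succ _ _

lemma lieSeries_zero_left (f : E → E) (w : E → F) (m : ℕ) (x : E) :
    lieSeries f w (m + 1) (0, x) = w x := by
  simp [lieSeries, Finset.sum_range_succ']

lemma hasDerivAt_lieSeries (f : E → E) (w : E → F) (m : ℕ) (h : ℝ) (x : E) :
    HasDerivAt (fun t => lieSeries f w (m + 1) (t, x)) (lieSeries f (lieDeriv f w) m (h, x)) h := by
  have h1 : ∀ k ∈ Finset.range m, HasDerivAt
      (fun t : ℝ => (t ^ (k + 1) / (k + 1).factorial) • (lieDeriv f)^[k + 1] w x)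
      ((h ^ k / k.factorial) • (lieDeriv f)^[k] (lieDeriv f w) x) h := by
    intro k _
    rw [Function.iterate_succ_apply]
    refine HasDerivAt.smul_const ?_ _
    have h2 := (hasDerivAt_pow (k + 1) h).div_const ((k + 1).factorial : ℝ)
    convert h2 using 1
    rw [Nat.factorial_succ]
    have h3 : (k.factorial : ℝ) ≠ 0 := by positivity
    have h4 : (k : ℝ) + 1 ≠ 0 := by positivity
    push_cast
    field_simp
  have h5 := (HasDerivAt.fun_sum h1).add_const (w x)
  simpa [lieSeries, Finset.sum_range_succ' _ m] using h5

lemma hasFDerivAt_lieSeries {f : E → E} {w : E → F} (hf : ContDiff ℝ ∞ f)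
    (hw : ContDiff ℝ ∞ w) (m : ℕ) (h : ℝ) (x : E) :
    HasFDerivAt (fun z => lieSeries f w m (h, z))
      (∑ k ∈ Finset.range m, (h ^ k / k.factorial : ℝ) • fderiv ℝ ((lieDeriv f)^[k] w) x) x :=
  HasFDerivAt.fun_sum fun k _ =>
    ((contDiff_iterate_lieDeriv hf hw k).differentiable (by simp) x).hasFDerivAt.fun_const_smul
      (h ^ k / k.factorial : ℝ)

lemma dx_lieSeries {f : E → E} {w : E → F} (hf : ContDiff ℝ ∞ f)
    (hw : ContDiff ℝ ∞ w) (m : ℕ) (q : ℝ × E) :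
    dx f (lieSeries f w m) q = lieSeries f (lieDeriv f w) m q := by
  rw [dx_eq ((contDiff_lieSeries hf hw m).differentiable (by simp) q)
    (hasFDerivAt_lieSeries hf hw m q.1 q.2)]
  simp only [sum_apply, smul_apply, lieSeries,
    ← Function.iterate_succ_apply, Function.iterate_succ_apply']
  rfl

/-- The Lie series is the expansion of `w` along a solution of `y' = f(y)`. -/
lemma isBigO_comp_solution_sub_lieSeries {f : E → E} {w : E → F} (hf : ContDiff ℝ ∞ f)
    (hw : ContDiff ℝ ∞ w) {y : ℝ → E} (hy : ∀ᶠ t in 𝓝 (0 : ℝ), HasDerivAt y (f (y t)) t) (m : ℕ) :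
    (fun h => w (y h) - lieSeries f w m (h, y 0)) =O[𝓝 0] fun h => h ^ m := by
  induction m generalizing w with
  | zero =>
    simpa [lieSeries] using
      (hw.continuous.continuousAt.comp hy.self_of_nhds.continuousAt).isBigO_one ℝ
  | succ m ih =>
    refine isBigO_pow_succ_of_deriv (hy.mono fun t ht => ?_)
      (by rw [lieSeries_zero_left, sub_self]) (ih (contDiff_lieDeriv hf hw))
    exact ((hw.differentiable (by simp) (y t)).hasFDerivAt.comp_hasDerivAt t ht).sub
      (hasDerivAt_lieSeries f w m t (y 0))

end LieSeries

/-! ### The inverse modified equation -/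

section Expansion

variable {n : ℕ}

lemma Integrator.germSmooth_family (Φ : Integrator n) {P : Type*} [NormedAddCommGroup P]
    [NormedSpace ℝ P] [FiniteDimensional ℝ P] {g : P → PhaseSpace n → PhaseSpace n}
    (hg : ContDiff ℝ ∞ fun q : P × PhaseSpace n => g q.1 q.2) :
    GermSmooth fun q : ℝ × (P × PhaseSpace n) => Φ.step (g q.2.1) q.1 q.2.2 := by
  rintro ⟨p, x⟩
  let e : P ≃L[ℝ] EuclideanSpace ℝ (Fin (Module.finrank ℝ P)) :=
    ContinuousLinearEquiv.ofFinrankEq (by simp)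
  have h1 := Φ.smooth_step _ (fun a => g (e.symm a)) (hg.comp
    ((e.symm.contDiff.comp contDiff_fst).prodMk contDiff_snd)) (e p) x
  have h2 : ContDiffAt ℝ ∞ (fun q : ℝ × (P × PhaseSpace n) => (e q.2.1, q.1, q.2.2))
      (0, (p, x)) :=
    ((e.contDiff.comp (contDiff_fst.comp contDiff_snd)).prodMk
      (contDiff_fst.prodMk (contDiff_snd.comp contDiff_snd))).contDiffAt
  simpa [Function.comp_def] using ContDiffAt.comp (0, (p, x)) h1 h2

/-- Consistency of the integrator, uniformly in the parameters of a family of vector fields. -/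
lemma Integrator.flat_two_family (Φ : Integrator n) {P : Type*} [NormedAddCommGroup P]
    [NormedSpace ℝ P] [FiniteDimensional ℝ P] {g : P → PhaseSpace n → PhaseSpace n}
    (hg : ContDiff ℝ ∞ fun q : P × PhaseSpace n => g q.1 q.2) :
    GermSmooth (fun q : ℝ × (P × PhaseSpace n) =>
      Φ.step (g q.2.1) q.1 q.2.2 - (q.2.2 + q.1 • g q.2.1 q.2.2)) ∧
    Flat 2 (fun q : ℝ × (P × PhaseSpace n) =>
      Φ.step (g q.2.1) q.1 q.2.2 - (q.2.2 + q.1 • g q.2.1 q.2.2)) := by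
  have hg' : ∀ p, ContDiff ℝ ∞ (g p) := fun p => hg.comp (contDiff_const.prodMk contDiff_id)
  have h1 : GermSmooth (fun q : ℝ × (P × PhaseSpace n) =>
      Φ.step (g q.2.1) q.1 q.2.2 - (q.2.2 + q.1 • g q.2.1 q.2.2)) :=
    (Φ.germSmooth_family hg).sub (.of_contDiff ((contDiff_snd.comp contDiff_snd).add
      (contDiff_fst.smul (hg.comp contDiff_snd))))
  refine ⟨h1, Vanishes.flat ⟨fun p => ?_, fun p => ?_, trivial⟩ h1⟩
  · simp [Φ.step_zero _ (hg' p.1)]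
  · refine dh_eq (h1.eventually_differentiableAt p).self_of_nhds ?_
    have h2 := (Φ.consistent _ (hg' p.1) p.2).sub
      (((hasDerivAt_id (0 : ℝ)).smul_const (g p.1 p.2)).const_add p.2)
    simpa using! h2

/-- The sum of the first `j` terms of the formal vector field `∑ h ^ k F k`. -/
def partialSum (F : ℕ → PhaseSpace n → PhaseSpace n) (j : ℕ) (h : ℝ) (y : PhaseSpace n) :
    PhaseSpace n :=
  ∑ k ∈ Finset.range j, h ^ k • F k y

lemma partialSum_congr {F F' : ℕ → PhaseSpace n → PhaseSpace n} {j : ℕ}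
    (h : ∀ k < j, F k = F' k) : partialSum F j = partialSum F' j := by
  funext t y
  exact Finset.sum_congr rfl fun k hk => by rw [h k (Finset.mem_range.1 hk)]

lemma contDiff_partialSum {F : ℕ → PhaseSpace n → PhaseSpace n} (hF : ∀ k, ContDiff ℝ ∞ (F k))
    (j : ℕ) : ContDiff ℝ ∞ fun q : ℝ × PhaseSpace n => partialSum F j q.1 q.2 := by
  unfold partialSum
  fun_prop

/-- The numerical solution `Φ_{h,g}(x)` for the vector field `g = ∑ k < j, h ^ k F k`, as a
function of `h` and `x`. -/
def numFlow (Φ : Integrator n) (F : ℕ → PhaseSpace n → PhaseSpace n) (j : ℕ)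
    (q : ℝ × PhaseSpace n) : PhaseSpace n :=
  Φ.step (partialSum F j q.1) q.1 q.2

variable {Φ : Integrator n} {f : PhaseSpace n → PhaseSpace n}
  {F F' : ℕ → PhaseSpace n → PhaseSpace n}

lemma germSmooth_numFlow (hF : ∀ k, ContDiff ℝ ∞ (F k)) (j : ℕ) :
    GermSmooth (numFlow Φ F j) :=
  (Φ.germSmooth_family (contDiff_partialSum hF j)).comp (φ := fun q => (q.1, (q.1, q.2)))
    (by fun_prop) fun _ => rfl

lemma contDiff_partialSum_slice (hF : ∀ k, ContDiff ℝ ∞ (F k)) (j : ℕ) (h : ℝ) :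
    ContDiff ℝ ∞ (partialSum F j h) :=
  (contDiff_partialSum hF j).comp (contDiff_const.prodMk contDiff_id)

lemma numFlow_zero_left (hF : ∀ k, ContDiff ℝ ∞ (F k)) (j : ℕ) (x : PhaseSpace n) :
    numFlow Φ F j (0, x) = x :=
  Φ.step_zero _ (contDiff_partialSum_slice hF j 0) x

/-- The term `h ^ j F j` of the vector field first enters the numerical solution as
`h ^ (j + 1) F j (x)`. -/
lemma flat_numFlow_succ (Φ : Integrator n) (hF : ∀ k, ContDiff ℝ ∞ (F k)) (j : ℕ) :
    Flat (j + 2) fun q : ℝ × PhaseSpace n =>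
      numFlow Φ F (j + 1) q - numFlow Φ F j q - q.1 ^ (j + 1) • F j q.2 := by
  refine Flat.of_isBigO (((germSmooth_numFlow hF _).sub (germSmooth_numFlow hF _)).sub
    (.pow_smul _ (hF j))) fun x => ?_
  -- `F j` is multiplied by a parameter of its own, which is then set to `h ^ j` or to `0`.
  let g : ℝ × ℝ → PhaseSpace n → PhaseSpace n := fun p y => partialSum F j p.2 y + p.1 • F j y
  have hg : ContDiff ℝ ∞ fun q : (ℝ × ℝ) × PhaseSpace n => g q.1 q.2 :=
    ((contDiff_partialSum hF j).comp ((contDiff_snd.comp contDiff_fst).prodMk contDiff_snd)).add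
      ((contDiff_fst.comp contDiff_fst).smul ((hF j).comp contDiff_snd))
  obtain ⟨h1, h2⟩ := Φ.flat_two_family hg
  set T : ℝ × ((ℝ × ℝ) × PhaseSpace n) → PhaseSpace n := fun q =>
    Φ.step (g q.2.1) q.1 q.2.2 - (q.2.2 + q.1 • g q.2.1 q.2.2) with hT
  let φ : ℝ × (ℝ × (ℝ × PhaseSpace n)) → ℝ × ((ℝ × ℝ) × PhaseSpace n) :=
    fun q => (q.1, ((q.2.1, q.2.2.1), q.2.2.2))
  have hφ : ContDiff ℝ ∞ φ := by fun_prop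
  have h3 : GermSmooth fun q => T (φ q) := h1.comp hφ fun _ => rfl
  have h4 : Flat 2 fun q => T (φ q) := h2.comp hφ.continuous fun _ => rfl
  have e1 : ∀ h, g (h ^ j, h) = partialSum F (j + 1) h := fun h => by
    funext y; simp [g, partialSum, Finset.sum_range_succ]
  have e2 : ∀ h, g (0, h) = partialSum F j h := fun h => by funext y; simp [g]
  have e3 : (fun h => T (φ (h, (h ^ j, (h, x)))) - T (φ (h, (0, (h, x))))) = fun h =>
      numFlow Φ F (j + 1) (h, x) - numFlow Φ F j (h, x) - h ^ (j + 1) • F j x := by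
    funext h
    simp only [hT, φ, e1, e2, numFlow]
    have : partialSum F (j + 1) h x = partialSum F j h x + h ^ j • F j x :=
      Finset.sum_range_succ _ _
    rw [this, smul_add, smul_smul, ← pow_succ']
    abel
  have hb : Tendsto (fun h : ℝ => (h, x)) (𝓝 0) (𝓝 (0, x)) := tendsto_mk_nhds_zero x
  rw [← e3]
  -- For `j = 0` the parameter `h ^ j = 1` does not tend to `0`, but consistency alone suffices.
  rcases Nat.eq_zero_or_pos j with rfl | hj
  · have h5 : ∀ p : ℝ, Tendsto (fun h : ℝ => (h, (p, (h, x)))) (𝓝 0) (𝓝 (0, (p, (0, x)))) :=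
      fun p => tendsto_id.prodMk_nhds (tendsto_const_nhds.prodMk_nhds hb)
    have h6 := (h4 (1, (0, x))).comp_tendsto (h5 1)
    have h7 := (h4 (0, (0, x))).comp_tendsto (h5 0)
    simpa [Function.comp_def] using h6.sub h7
  · have h5 := h4.isBigO_sub_param h3 (a := fun h => h ^ j) (b := fun h => (h, x))
      ((continuous_pow j).tendsto' 0 0 (by simp [hj.ne'])) hb
    simpa [← pow_add, add_comm] using h5

/-- The numerical solution for the first `j` terms of `F` agrees with the exact solution of
`y' = f(y)` up to `O(h ^ (j + 1))`. -/
def Expands (Φ : Integrator n) (f : PhaseSpace n → PhaseSpace n)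
    (F : ℕ → PhaseSpace n → PhaseSpace n) (j : ℕ) : Prop :=
  Flat (j + 1) fun q => numFlow Φ F j q - lieSeries f id (j + 1) q

lemma Expands.congr {j : ℕ} (h : Expands Φ f F j) (hF : ∀ k < j, F k = F' k) :
    Expands Φ f F' j := by
  have : numFlow Φ F j = numFlow Φ F' j := by
    funext q; simp only [numFlow, partialSum_congr hF]
  rwa [Expands, ← this]

lemma expands_zero (hf : ContDiff ℝ ∞ f) (hF : ∀ k, ContDiff ℝ ∞ (F k)) : Expands Φ f F 0 := by
  have h1 := (germSmooth_numFlow (Φ := Φ) hF 0).sub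
    (.of_contDiff (contDiff_lieSeries hf contDiff_id 1))
  exact Vanishes.flat
    ⟨fun x => by simp [numFlow_zero_left hF, lieSeries_zero_left], trivial⟩ h1

lemma flat_pow_smul_eq_zero {m : ℕ} {c : PhaseSpace n → PhaseSpace n}
    (h : Flat (m + 1) fun q : ℝ × PhaseSpace n => q.1 ^ m • c q.2) (x : PhaseSpace n) : c x = 0 :=
  eq_zero_of_pow_smul_isBigO (h.isBigO x)

/-- If the first `j` coefficients are right, then exactly one choice of the next one is. -/
lemma Expands.exists_next {j : ℕ} (h : Expands Φ f F j) (hf : ContDiff ℝ ∞ f)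
    (hF : ∀ k, ContDiff ℝ ∞ (F k)) :
    ∃ c, ContDiff ℝ ∞ c ∧ ∀ F' : ℕ → PhaseSpace n → PhaseSpace n, (∀ k, ContDiff ℝ ∞ (F' k)) →
      (∀ k < j, F k = F' k) → (Expands Φ f F' (j + 1) ↔ F' j = c) := by
  have hD := contDiff_iterate_lieDeriv hf (contDiff_id (𝕜 := ℝ) (E := PhaseSpace n)) (j + 1)
  have hD' : ContDiff ℝ ∞ (fun x => ((j + 1).factorial : ℝ)⁻¹ • (lieDeriv f)^[j + 1] id x) := by
    fun_prop
  have h1 : Flat (j + 1) fun q => numFlow Φ F j q - lieSeries f id (j + 2) q := by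
    have := h.sub (flat_pow_smul (j + 1) hD')
    refine this.congr fun x => .of_forall fun q => ?_
    simp only [lieSeries_succ f id (j + 1), smul_smul, div_eq_mul_inv]
    abel
  have hs := (germSmooth_numFlow (Φ := Φ) hF j).sub
    (.of_contDiff (contDiff_lieSeries hf contDiff_id (j + 2)))
  obtain ⟨c, hc, h2⟩ := h1.exists_leading hs
  refine ⟨fun x => -c x, hc.neg, fun F' hF' hFF' => ?_⟩
  have e1 : numFlow Φ F j = numFlow Φ F' j := by
    funext q; simp only [numFlow, partialSum_congr hFF']
  have h3 := (flat_numFlow_succ Φ hF' j).add h2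
  rw [e1] at h3
  constructor
  · intro h4
    have h5 : Flat (j + 1 + 1) fun q : ℝ × PhaseSpace n => q.1 ^ (j + 1) • (F' j q.2 + c q.2) := by
      refine (Flat.sub h4 h3).congr fun x => .of_forall fun q => ?_
      simp only [smul_add]
      abel
    funext x
    exact eq_neg_of_add_eq_zero_left (flat_pow_smul_eq_zero (c := fun x => F' j x + c x) h5 x)
  · intro h4
    refine h3.congr fun x => .of_forall fun q => ?_
    simp only [h4, smul_neg]
    abel

lemma Expands.eq_of_agree (hf : ContDiff ℝ ∞ f) (hF : ∀ k, ContDiff ℝ ∞ (F k))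
    (hF' : ∀ k, ContDiff ℝ ∞ (F' k)) {K : ℕ} (h : ∀ j ≤ K, Expands Φ f F j)
    (h' : ∀ j ≤ K, Expands Φ f F' j) : ∀ j < K, F j = F' j := by
  intro j
  induction j using Nat.strong_induction_on with
  | _ j ih =>
    intro hj
    obtain ⟨c, -, hc⟩ := (h j hj.le).exists_next hf hF
    rw [(hc F hF fun _ _ => rfl).1 (h _ hj),
      (hc F' hF' fun k hk => ih k hk (hk.trans hj)).1 (h' _ hj)]

lemma exists_expands (Φ : Integrator n) (hf : ContDiff ℝ ∞ f) :
    ∃ F : ℕ → PhaseSpace n → PhaseSpace n, (∀ k, ContDiff ℝ ∞ (F k)) ∧ ∀ j, Expands Φ f F j := by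
  have h1 : ∀ K, ∃ F : ℕ → PhaseSpace n → PhaseSpace n,
      (∀ k, ContDiff ℝ ∞ (F k)) ∧ ∀ j ≤ K, Expands Φ f F j := by
    intro K
    induction K with
    | zero =>
      have h0 : ∀ k : ℕ, ContDiff ℝ ∞ fun _ : PhaseSpace n => (0 : PhaseSpace n) :=
        fun _ => contDiff_const
      refine ⟨fun _ _ => 0, h0, fun j hj => ?_⟩
      rw [Nat.le_zero.1 hj]
      exact expands_zero hf h0
    | succ K ih =>
      obtain ⟨F, hF, hE⟩ := ih
      obtain ⟨c, hc, hc'⟩ := (hE K le_rfl).exists_next hf hF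
      have hne : ∀ k < K, F k = Function.update F K c k := fun k hk => by
        rw [Function.update_of_ne hk.ne]
      have hs : ∀ k, ContDiff ℝ ∞ (Function.update F K c k) := fun k => by
        rcases eq_or_ne k K with rfl | hk
        · simpa using hc
        · simpa [hk] using hF k
      refine ⟨Function.update F K c, hs, fun j hj => ?_⟩
      rcases Nat.le_succ_iff.1 hj with hj | rfl
      · exact (hE j hj).congr fun k hk => hne k (hk.trans_le hj)
      · exact (hc' _ hs hne).2 (by simp)
  choose Fs hs hE using h1
  refine ⟨fun k => Fs (k + 1) k, fun k => hs _ k, fun j => (hE j j le_rfl).congr fun k hk => ?_⟩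
  exact Expands.eq_of_agree (K := k + 1) hf (hs j) (hs (k + 1))
    (fun i hi => hE j i (hi.trans hk)) (fun i hi => hE (k + 1) i hi) k k.lt_succ_self

lemma exists_solution (hf : ContDiff ℝ ∞ f) (x : PhaseSpace n) :
    ∃ y : ℝ → PhaseSpace n, y 0 = x ∧ ∀ᶠ t in 𝓝 (0 : ℝ), HasDerivAt y (f (y t)) t := by
  obtain ⟨y, hy, ε, hε, h⟩ :=
    ((hf.of_le (m := 1) (by norm_cast)).contDiffAt
      (x := x)).exists_forall_mem_closedBall_exists_eq_forall_mem_Ioo_hasDerivAt₀ 0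
  exact ⟨y, hy, Filter.mem_of_superset (Ioo_mem_nhds (by linarith) (by linarith)) h⟩

lemma isIMDE_iff (hf : ContDiff ℝ ∞ f) :
    IsIMDE Φ f F ↔ (∀ k, ContDiff ℝ ∞ (F k)) ∧ ∀ j, Expands Φ f F j := by
  refine and_congr_right fun hF => ⟨fun h j => ?_, fun h x y hy hd K => ?_⟩
  · cases j with
    | zero => exact expands_zero hf hF
    | succ j =>
      refine Flat.of_isBigO ((germSmooth_numFlow hF _).sub
        (.of_contDiff (contDiff_lieSeries hf contDiff_id _))) fun x => ?_
      obtain ⟨y, rfl, hd⟩ := exists_solution hf x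
      have h1 := (h _ y rfl hd j).add
        (isBigO_comp_solution_sub_lieSeries hf contDiff_id hd (j + 2))
      simpa using! h1
  · have h1 := ((h (K + 1)).isBigO x).sub
      (isBigO_comp_solution_sub_lieSeries hf contDiff_id hd (K + 2))
    rw [hy] at h1
    simpa using! h1

theorem existsUnique_isIMDE (Φ : Integrator n) (hf : ContDiff ℝ ∞ f) : ∃! F, IsIMDE Φ f F := by
  simp only [isIMDE_iff hf]
  obtain ⟨F, hF, hE⟩ := exists_expands Φ hf
  refine ⟨F, ⟨hF, hE⟩, fun F' h' => funext fun k => ?_⟩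
  exact Expands.eq_of_agree (K := k + 1) hf h'.1 hF (fun i _ => h'.2 i) (fun i _ => hE i) k
    k.lt_succ_self

/-- By consistency, the inverse modified vector field is a perturbation of `f`. -/
lemma Expands.zero_eq (hf : ContDiff ℝ ∞ f) (hF : ∀ k, ContDiff ℝ ∞ (F k))
    (h : Expands Φ f F 1) : F 0 = f := by
  have hf' : ∀ k : ℕ, ContDiff ℝ ∞ f := fun _ => hf
  obtain ⟨c, -, hc⟩ := (expands_zero (Φ := Φ) hf hF).exists_next hf hF
  rw [(hc F hF (by simp)).1 h, ← (hc (fun _ => f) hf' (by simp)).1 ?_]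
  have h1 := (Φ.flat_two_family (P := ℝ) (g := fun _ => f) (hf.comp contDiff_snd)).2.comp
    (φ := fun q : ℝ × PhaseSpace n => (q.1, (q.1, q.2))) (by fun_prop) fun _ => rfl
  refine h1.congr fun x => .of_forall fun q => ?_
  have e1 : partialSum (fun _ => f) 1 q.1 = f := by funext y; simp [partialSum]
  have e2 : lieDeriv f id q.2 = f q.2 := by simp [lieDeriv]
  simp [numFlow, e1, lieSeries, Finset.sum_range_succ, e2]

/-- To the order in question the numerical solution satisfies the transport equation
`∂u/∂h = u' f` of the exact flow. -/
lemma Expands.transport {j : ℕ} (h : Expands Φ f F j) (hf : ContDiff ℝ ∞ f)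
    (hF : ∀ k, ContDiff ℝ ∞ (F k)) :
    Flat j fun q => dh (numFlow Φ F j) q - dx f (numFlow Φ F j) q := by
  have hψ := germSmooth_numFlow (Φ := Φ) hF j
  have hS := contDiff_lieSeries hf (contDiff_id (𝕜 := ℝ) (E := PhaseSpace n)) (j + 1)
  have hs := hψ.sub (.of_contDiff hS)
  have h1 := (((flat_succ_iff hs).1 h).2.sub ((h.dx hs hf).mono j.le_succ))
  have hL := contDiff_lieDeriv hf (contDiff_id (𝕜 := ℝ) (E := PhaseSpace n))
  have hD := contDiff_iterate_lieDeriv hf hL j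
  have hD' : ContDiff ℝ ∞ (fun x => (j.factorial : ℝ)⁻¹ • (lieDeriv f)^[j] (lieDeriv f id) x) := by
    fun_prop
  refine (h1.sub (flat_pow_smul j hD')).congr fun x => ?_
  filter_upwards [hψ.eventually_differentiableAt x] with q hq
  have hSq := hS.differentiable (by simp) q
  rw [dh_sub hq hSq, dx_sub hq hSq, dx_lieSeries hf contDiff_id,
    dh_eq hSq (hasDerivAt_lieSeries f id j q.1 q.2), lieSeries_succ, smul_smul, div_eq_mul_inv]
  abel

end Expansion

/-! ### Invariant bilinear forms of the transport equation -/

section Transport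

variable {E F : Type*} [NormedAddCommGroup E] [NormedSpace ℝ E]
  [NormedAddCommGroup F] [NormedSpace ℝ F]

/-- Formal uniqueness for the transport equation `∂T/∂h = L_f T`: if its initial value `w` is a
first integral of `f`, the solution is constant in `h`. -/
lemma flat_sub_of_transport {T : ℝ × E → F} {f : E → E} {w : E → F} {m : ℕ}
    (hT : GermSmooth T) (hf : ContDiff ℝ ∞ f) (hw : ContDiff ℝ ∞ w)
    (h : Flat m fun q => dh T q - dx f T q) (h0 : ∀ x, T (0, x) = w x)
    (hfw : ∀ x, lieDeriv f w x = 0) : Flat (m + 1) fun q => T q - w q.2 := by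
  have hw' : ContDiff ℝ ∞ fun q : ℝ × E => w q.2 := hw.comp contDiff_snd
  have hs : GermSmooth fun q => T q - w q.2 := hT.sub (.of_contDiff hw')
  have key : ∀ j ≤ m + 1, Flat j fun q => T q - w q.2 := by
    intro j
    induction j with
    | zero => exact fun _ => Vanishes.flat (m := 0) trivial hs
    | succ j ih =>
      intro hj
      refine (flat_succ_iff hs).2 ⟨fun x => by simp [h0], ?_⟩
      have h1 := (ih (j.le_succ.trans hj)).dx hs hf
      refine ((h.mono (Nat.le_of_succ_le_succ hj)).add h1).congr fun x => ?_
      filter_upwards [hT.eventually_differentiableAt x] with q hq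
      have hwq := hw'.differentiable (by simp) q
      have e1 : dh (fun q : ℝ × E => w q.2) q = 0 := dh_eq hwq (hasDerivAt_const q.1 (w q.2))
      have e2 : dx f (fun q : ℝ × E => w q.2) q = 0 :=
        (dx_eq hwq (hw.differentiable (by simp) q.2).hasFDerivAt).trans (hfw q.2)
      rw [dx_sub hq hwq, dh_sub hq hwq, e1, e2]
      abel
  exact key _ le_rfl

lemma isBigO_bilinear (B : E →L[ℝ] E →L[ℝ] ℝ) {a b : ℝ → E} {m k : ℕ}
    (ha : a =O[𝓝 0] fun h => h ^ m) (hb : b =O[𝓝 0] fun h => h ^ k) :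
    (fun h => B (a h) (b h)) =O[𝓝 0] fun h => h ^ (m + k) := by
  have h1 : (fun h => B (a h) (b h)) =O[𝓝 0] fun h => ‖a h‖ * ‖b h‖ :=
    B.isBoundedBilinearMap.isBigO_comp
  simpa [pow_add] using h1.trans (ha.norm_left.mul hb.norm_left)

lemma GermSmooth.isBigO_one {T : ℝ × E → F} (hT : GermSmooth T) (x : E) :
    (fun h => T (h, x)) =O[𝓝 0] fun h => h ^ 0 :=
  Flat.isBigO (m := 0) (Vanishes.flat (m := 0) trivial hT) x

/-- If `ψ` solves the transport equation of `f` to order `m` and `f` is an infinitesimal symmetry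
of the bilinear form `B`, then the maps `ψ (h, ·)` preserve `B` to order `m`. The pulled back form
`B (ψ' u) (ψ' v)`, as a function of `h` and `(x, u, v)`, solves the transport equation of the
tangent lift `(f, f' u, f' v)` of `f`. -/
lemma flat_pullback_sub {ψ : ℝ × E → E} {f : E → E} {m : ℕ} (B : E →L[ℝ] E →L[ℝ] ℝ)
    (hψ : GermSmooth ψ) (hf : ContDiff ℝ ∞ f) (h : Flat m fun q => dh ψ q - dx f ψ q)
    (h0 : ∀ x, ψ (0, x) = x) (hB : ∀ x u v, B (fderiv ℝ f x u) v + B u (fderiv ℝ f x v) = 0) :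
    Flat (m + 1) fun q : ℝ × (E × (E × E)) =>
      B (fderiv ℝ ψ (q.1, q.2.1) (0, q.2.2.1)) (fderiv ℝ ψ (q.1, q.2.1) (0, q.2.2.2)) -
        B q.2.2.1 q.2.2.2 := by
  let fl : E × (E × E) → E × (E × E) := fun z =>
    (f z.1, (fderiv ℝ f z.1 z.2.1, fderiv ℝ f z.1 z.2.2))
  have hf' : ContDiff ℝ ∞ (fderiv ℝ f) := hf.fderiv_right (by simp)
  have hfl : ContDiff ℝ ∞ fl := (hf.comp contDiff_fst).prodMk
    (((hf'.comp contDiff_fst).clm_apply (contDiff_fst.comp contDiff_snd)).prodMk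
      ((hf'.comp contDiff_fst).clm_apply (contDiff_snd.comp contDiff_snd)))
  have hBs : ContDiff ℝ ∞ fun z : E × (E × E) => B z.2.1 z.2.2 :=
    B.isBoundedBilinearMap.contDiff.comp contDiff_snd
  have hG : ∀ l : E × (E × E) →L[ℝ] E, GermSmooth fun q : ℝ × (E × (E × E)) =>
      fderiv ℝ ψ (q.1, q.2.1) (0, l q.2) := fun l z =>
    ((hψ.fderiv.comp (φ := fun q : ℝ × (E × (E × E)) => (q.1, q.2.1)) (by fun_prop)
      fun _ => rfl) z).clm_apply
      (contDiffAt_const.prodMk ((l.contDiff.comp contDiff_snd).contDiffAt))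
  let l1 : E × (E × E) →L[ℝ] E := (ContinuousLinearMap.fst ℝ E E).comp (.snd ℝ E (E × E))
  let l2 : E × (E × E) →L[ℝ] E := (ContinuousLinearMap.snd ℝ E E).comp (.snd ℝ E (E × E))
  -- `T` is the pulled back form; the residual of its transport equation is
  -- `B (ρ' u) (ψ' v) + B (ψ' u) (ρ' v)`, where `ρ` is the residual of `ψ`.
  set T : ℝ × (E × (E × E)) → ℝ := fun q =>
    B (fderiv ℝ ψ (q.1, q.2.1) (0, q.2.2.1)) (fderiv ℝ ψ (q.1, q.2.1) (0, q.2.2.2))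
  have hT : GermSmooth T := fun z =>
    B.isBoundedBilinearMap.contDiff.contDiffAt.comp ((0 : ℝ), z) ((hG l1 z).prodMk (hG l2 z))
  have hρ : GermSmooth fun q => dh ψ q - dx f ψ q := hψ.dh.sub (hψ.dx hf)
  have hid : ∀ x u, fderiv ℝ ψ (0, x) (0, u) = u := fun x u => by
    have h1 := hasFDerivAt_slice (hψ.eventually_differentiableAt x).self_of_nhds
    simp only [h0] at h1
    exact congrArg (fun L => L u) (h1.unique (hasFDerivAt_id x))
  refine flat_sub_of_transport (f := fl) (w := fun z => B z.2.1 z.2.2) hT hfl hBs ?_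
    (fun z => by simp [hid]) (fun z => ?_)
  · refine Flat.of_isBigO (hT.dh.sub (hT.dx hfl)) ?_
    rintro ⟨x, u, v⟩
    have hρu : ∀ u, (fun t => fderiv ℝ (fun q => dh ψ q - dx f ψ q) (t, x) (0, u))
        =O[𝓝 0] fun t => t ^ m := fun u =>
      (h.dx hρ (w := fun _ => u) contDiff_const).isBigO x
    have hψu : ∀ u, (fun t => fderiv ℝ ψ (t, x) (0, u)) =O[𝓝 0] fun t => t ^ 0 := fun u =>
      (hψ.dx (w := fun _ => u) contDiff_const).isBigO_one x
    have h1 := (isBigO_bilinear B (hρu u) (hψu v)).add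
      ((isBigO_bilinear B (hψu u) (hρu v)).congr_right fun t => by rw [zero_add, add_zero])
    refine h1.congr' ?_ EventuallyEq.rfl
    filter_upwards [(tendsto_mk_nhds_zero x).eventually (hψ.eventually x)] with t ht
    have hs : IsSymmSndFDerivAt ℝ ψ (t, x) := ht.isSymmSndFDerivAt (by simp)
    have h3 : HasFDerivAt (fderiv ℝ ψ) (fderiv ℝ (fderiv ℝ ψ) (t, x)) (t, x) :=
      ((ht.fderiv_right (m := 1) (by norm_num)).differentiableAt (by simp)).hasFDerivAt
    have hq : HasFDerivAt (fun q : ℝ × (E × (E × E)) => (q.1, q.2.1))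
        ((ContinuousLinearMap.fst ℝ ℝ (E × (E × E))).prod
          ((ContinuousLinearMap.fst ℝ E (E × E)).comp
            (ContinuousLinearMap.snd ℝ ℝ (E × (E × E))))) (t, (x, (u, v))) :=
      hasFDerivAt_fst.prodMk (hasFDerivAt_fst.comp _ hasFDerivAt_snd)
    have hA := HasFDerivAt.comp (t, (x, (u, v))) (g := fderiv ℝ ψ) h3 hq
    have hD : ∀ l : E × (E × E) →L[ℝ] E, _ := fun l => hA.clm_apply
      ((hasFDerivAt_const (0 : ℝ) (t, (x, (u, v)))).prodMk
        (HasFDerivAt.comp (t, (x, (u, v))) (g := l) l.hasFDerivAt hasFDerivAt_snd))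
    have hTq : HasFDerivAt T _ (t, (x, (u, v))) := B.hasFDerivAt_of_bilinear (hD l1) (hD l2)
    have h4 := h3.clm_apply (hasFDerivAt_const ((1 : ℝ), (0 : E)) (t, x))
    have h5 := h3.clm_apply ((hasFDerivAt_const (0 : ℝ) (t, x)).prodMk
        (HasFDerivAt.comp (t, x) (g := f) (hf.differentiable (by simp) x).hasFDerivAt
          hasFDerivAt_snd))
    have h6 : ∀ u, fderiv ℝ (fun q => dh ψ q - dx f ψ q) (t, x) (0, u) = _ := fun u =>
      congrArg (fun L => L (0, u)) (h4.sub h5).fderiv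
    have h7 : dh T (t, (x, (u, v))) = _ := congrArg (fun L => L (1, 0)) hTq.fderiv
    have h8 : dx fl T (t, (x, (u, v))) = _ :=
      congrArg (fun L => L (0, fl (x, (u, v)))) hTq.fderiv
    rw [h6, h6, h7, h8]
    have s1 := hs.eq (1, 0) (0, u)
    have s2 := hs.eq (1, 0) (0, v)
    have s3 := hs.eq (0, f x) (0, u)
    have s4 := hs.eq (0, f x) (0, v)
    simp [l1, l2, fl, s1, s2, s3, s4, Prod.mk_zero_zero]
    ring
  · have h1 := (B.hasFDerivAt_of_bilinear (l1.hasFDerivAt (x := z)) (l2.hasFDerivAt (x := z)))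
    have h2 : lieDeriv fl (fun z => B z.2.1 z.2.2) z = _ :=
      congrArg (fun L => L (fl z)) h1.fderiv
    rw [h2]
    simpa [l1, l2, fl, add_comm] using hB z.1 z.2.1 z.2.2

end Transport

/-! ### Hamiltonian vector fields -/

section Hamiltonian

variable {n : ℕ}

/-- The symplectic form `ω(u, v) = ⟨u, J v⟩`. -/
def symplecticForm (n : ℕ) : PhaseSpace n →L[ℝ] PhaseSpace n →L[ℝ] ℝ :=
  ((innerSL ℝ).flip.comp (Matrix.toEuclideanCLM (𝕜 := ℝ) (J n))).flip

lemma symplecticForm_apply (u v : PhaseSpace n) :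
    symplecticForm n u v = inner ℝ u (act (J n) v) := rfl

lemma J_mul_neg_J (n : ℕ) : J n * -J n = 1 := by
  simp [J, Matrix.fromBlocks_neg, Matrix.fromBlocks_multiply]

lemma inv_J (n : ℕ) : (J n)⁻¹ = -J n := Matrix.inv_eq_right_inv (J_mul_neg_J n)

lemma act_act (A B : Matrix (Fin n ⊕ Fin n) (Fin n ⊕ Fin n) ℝ) (v : PhaseSpace n) :
    act A (act B v) = act (A * B) v := by
  simp [act, Matrix.mulVec_mulVec]

lemma act_one (v : PhaseSpace n) : act 1 v = v := by simp [act]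

lemma act_J_inv (v : PhaseSpace n) : act (J n) (act (J n)⁻¹ v) = v := by
  rw [act_act, inv_J, J_mul_neg_J, act_one]

lemma act_inv_J (v : PhaseSpace n) : act (J n)⁻¹ (act (J n) v) = v := by
  rw [act_act, inv_J, neg_mul, ← mul_neg, J_mul_neg_J, act_one]

lemma contDiff_act (A : Matrix (Fin n ⊕ Fin n) (Fin n ⊕ Fin n) ℝ) :
    ContDiff ℝ ∞ (act A : PhaseSpace n → PhaseSpace n) :=
  (Matrix.toEuclideanCLM (𝕜 := ℝ) A).contDiff

lemma hasFDerivAt_act_comp (A : Matrix (Fin n ⊕ Fin n) (Fin n ⊕ Fin n) ℝ)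
    {f : PhaseSpace n → PhaseSpace n} {x : PhaseSpace n} (hf : DifferentiableAt ℝ f x) :
    HasFDerivAt (fun y => act A (f y))
      ((Matrix.toEuclideanCLM (𝕜 := ℝ) A).comp (fderiv ℝ f x)) x :=
  HasFDerivAt.comp x (g := Matrix.toEuclideanCLM (𝕜 := ℝ) A)
    (ContinuousLinearMap.hasFDerivAt _) hf.hasFDerivAt

lemma inner_act_J (u v : PhaseSpace n) :
    inner ℝ (act (J n) u) v = -inner ℝ u (act (J n) v) := by
  have h : (J n).transpose = -J n := by
    simp [J, Matrix.fromBlocks_transpose, Matrix.fromBlocks_neg]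
  simp only [act, EuclideanSpace.inner_eq_star_dotProduct, star_trivial]
  rw [Matrix.dotProduct_mulVec, ← Matrix.mulVec_transpose, h, Matrix.neg_mulVec, neg_dotProduct]

/-- The Lie derivative of the symplectic form along the vector field `f`. -/
def lieForm (f : PhaseSpace n → PhaseSpace n) (x u v : PhaseSpace n) : ℝ :=
  symplecticForm n (fderiv ℝ f x u) v + symplecticForm n u (fderiv ℝ f x v)

lemma lieForm_eq (f : PhaseSpace n → PhaseSpace n) (x u v : PhaseSpace n) :
    lieForm f x u v =
      inner ℝ u (act (J n) (fderiv ℝ f x v)) - inner ℝ (act (J n) (fderiv ℝ f x u)) v := by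
  rw [lieForm, symplecticForm_apply, symplecticForm_apply, inner_act_J]
  ring

lemma lieForm_eq_zero_of_hasGradientAt {f : PhaseSpace n → PhaseSpace n}
    {V : PhaseSpace n → ℝ} {x : PhaseSpace n} (hf : DifferentiableAt ℝ f x)
    (hV : ∀ᶠ y in 𝓝 x, HasGradientAt V (act (J n) (f y)) y) (u v : PhaseSpace n) :
    lieForm f x u v = 0 := by
  have h1 : HasFDerivAt (fun y => innerSL ℝ (act (J n) (f y)))
      ((innerSL ℝ).comp ((Matrix.toEuclideanCLM (𝕜 := ℝ) (J n)).comp (fderiv ℝ f x))) x :=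
    HasFDerivAt.comp x (g := innerSL ℝ) (ContinuousLinearMap.hasFDerivAt _)
      (hasFDerivAt_act_comp (J n) hf)
  have h2 := second_derivative_symmetric_of_eventually (𝕜 := ℝ) (f := V)
    (hV.mono fun _ hy => hy.hasFDerivAt) h1 u v
  rw [lieForm_eq, sub_eq_zero, real_inner_comm]
  exact h2.symm

lemma lieForm_eq_zero_of_isLocallyPotential {f : PhaseSpace n → PhaseSpace n}
    (hf : ContDiff ℝ ∞ f) (h : IsLocallyPotential fun y => act (J n) (f y))
    (x u v : PhaseSpace n) : lieForm f x u v = 0 := by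
  obtain ⟨U, hU, hx, V, hV, hVg⟩ := h x
  refine lieForm_eq_zero_of_hasGradientAt (V := V) (hf.differentiable (by simp) x) ?_ u v
  filter_upwards [hU.mem_nhds hx] with y hy
  have h1 : act (J n) (f y) = gradient V y := hVg y hy
  rw [h1]
  exact (hV.differentiableAt (hU.mem_nhds hy)).hasGradientAt

lemma contDiff_hamiltonianField {H : PhaseSpace n → ℝ} (hH : ContDiff ℝ ∞ H) :
    ContDiff ℝ ∞ (hamiltonianField H) :=
  (contDiff_act _).comp
    ((InnerProductSpace.toDual ℝ (PhaseSpace n)).symm.contDiff.comp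
      (hH.fderiv_right (m := ∞) (by simp)))

lemma lieForm_hamiltonianField {H : PhaseSpace n → ℝ} (hH : ContDiff ℝ ∞ H)
    (x u v : PhaseSpace n) : lieForm (hamiltonianField H) x u v = 0 := by
  refine lieForm_eq_zero_of_hasGradientAt (V := H)
    ((contDiff_hamiltonianField hH).differentiable (by simp) x) (.of_forall fun y => ?_) u v
  rw [hamiltonianField, act_J_inv]
  exact (hH.differentiable (by simp) y).hasGradientAt

/-- Poincaré's lemma: infinitesimal symmetries of the symplectic form are Hamiltonian. -/
lemma exists_hamiltonian {f : PhaseSpace n → PhaseSpace n} (hf : ContDiff ℝ ∞ f)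
    (h : ∀ x u v, lieForm f x u v = 0) :
    ∃ H : PhaseSpace n → ℝ, ContDiff ℝ ∞ H ∧ hamiltonianField H = f := by
  have hJf : ContDiff ℝ ∞ fun y => innerSL ℝ (act (J n) (f y)) :=
    (innerSL ℝ).contDiff.comp ((contDiff_act (J n)).comp hf)
  obtain ⟨H, hH⟩ := (convex_univ (𝕜 := ℝ)
    (E := PhaseSpace n)).exists_forall_hasFDerivAt_of_fderiv_symmetric isOpen_univ
    (hJf.differentiable (by simp)).differentiableOn fun x _ u v => by
      have h1 : HasFDerivAt (fun y => innerSL ℝ (act (J n) (f y)))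
          ((innerSL ℝ).comp ((Matrix.toEuclideanCLM (𝕜 := ℝ) (J n)).comp (fderiv ℝ f x))) x :=
        HasFDerivAt.comp x (g := innerSL ℝ) (ContinuousLinearMap.hasFDerivAt _)
          (hasFDerivAt_act_comp (J n) (hf.differentiable (by simp) x))
      have h2 := h x u v
      rw [lieForm_eq, sub_eq_zero, real_inner_comm] at h2
      rw [h1.fderiv]
      exact h2.symm
  have hH' : ∀ y, HasFDerivAt H (innerSL ℝ (act (J n) (f y))) y := fun y => hH y trivial
  refine ⟨H, ?_, funext fun y => ?_⟩
  · rw [contDiff_infty_iff_fderiv]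
    refine ⟨fun y => (hH' y).differentiableAt, ?_⟩
    simpa only [funext fun y => (hH' y).fderiv] using hJf
  · have : HasGradientAt H (act (J n) (f y)) y := (hH' y)
    rw [hamiltonianField, this.gradient, act_inv_J]

lemma lieForm_partialSum {F : ℕ → PhaseSpace n → PhaseSpace n}
    (hF : ∀ k, ContDiff ℝ ∞ (F k)) (j : ℕ) (h : ℝ) (x u v : PhaseSpace n) :
    lieForm (partialSum F j h) x u v = ∑ k ∈ Finset.range j, h ^ k * lieForm (F k) x u v := by
  have h1 : HasFDerivAt (partialSum F j h) (∑ k ∈ Finset.range j, h ^ k • fderiv ℝ (F k) x) x :=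
    HasFDerivAt.fun_sum fun k _ =>
      ((hF k).differentiable (by simp) x).hasFDerivAt.fun_const_smul (h ^ k)
  simp only [lieForm, h1.fderiv, sum_apply, smul_apply, map_sum, map_smul, smul_eq_mul,
    ← Finset.sum_add_distrib, mul_add]

lemma lieForm_eq_zero_of_single {f : PhaseSpace n → PhaseSpace n} {x : PhaseSpace n}
    (h : ∀ i j, lieForm f x (EuclideanSpace.single i 1) (EuclideanSpace.single j 1) = 0)
    (u v : PhaseSpace n) : lieForm f x u v = 0 := by
  let L : PhaseSpace n →L[ℝ] PhaseSpace n →L[ℝ] ℝ :=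
    (symplecticForm n).comp (fderiv ℝ f x) + ((symplecticForm n).flip.comp (fderiv ℝ f x)).flip
  have hL : L.toLinearMap₁₂ = 0 := by
    refine LinearMap.ext_basis (EuclideanSpace.basisFun (Fin n ⊕ Fin n) ℝ).toBasis
      (EuclideanSpace.basisFun (Fin n ⊕ Fin n) ℝ).toBasis fun i j => ?_
    simpa using! h i j
  exact congrArg (fun M => M u v) hL

/-- The defect of symplecticity of a map `g`, in coordinates and as a form. -/
lemma jacobian_form (g : PhaseSpace n → PhaseSpace n) (x : PhaseSpace n) (i j : Fin n ⊕ Fin n) :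
    ((jacobian g x).transpose * J n * jacobian g x - J n) i j =
      symplecticForm n (fderiv ℝ g x (EuclideanSpace.single i 1))
        (fderiv ℝ g x (EuclideanSpace.single j 1)) -
      symplecticForm n (EuclideanSpace.single i 1) (EuclideanSpace.single j 1) := by
  simp only [Matrix.sub_apply, symplecticForm_apply]
  congr 1
  · rw [Matrix.mul_assoc, Matrix.mul_apply]
    simp [PiLp.inner_apply, act, jacobian, Matrix.mul_apply, Matrix.mulVec, dotProduct, mul_comm]
  · simp [act, EuclideanSpace.inner_single_left]

end Hamiltonian

/-! ### The order of symplecticity -/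

section SymplecticOrder

variable {n : ℕ} {Φ : Integrator n} {f : PhaseSpace n → PhaseSpace n}
  {F : ℕ → PhaseSpace n → PhaseSpace n}

/-- The change of the symplectic form, evaluated at `u` and `v`, under the linear map `A`. -/
def formDefect (A : PhaseSpace n →L[ℝ] PhaseSpace n) (u v : PhaseSpace n) : ℝ :=
  symplecticForm n (A u) (A v) - symplecticForm n u v

lemma preservesForm_iff {r : ℕ} : PreservesForm Φ f r ↔ ∀ x i j,
    (fun h => formDefect (fderiv ℝ (Φ.step f h) x) (EuclideanSpace.single i 1)
      (EuclideanSpace.single j 1)) =O[𝓝 0] fun h => h ^ (r + 1) := by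
  simp only [PreservesForm, jacobian_form, formDefect]

lemma PreservesForm.mono {r s : ℕ} (h : PreservesForm Φ f r) (hs : s ≤ r) :
    PreservesForm Φ f s :=
  fun x i j => (h x i j).trans (pow_isBigO_pow (Nat.succ_le_succ hs))

/-- Derivative in `x` of the numerical solution at `(h, x)`. -/
lemma eventually_fderiv_numFlow (hF : ∀ k, ContDiff ℝ ∞ (F k)) (j : ℕ) (x : PhaseSpace n) :
    ∀ᶠ h in 𝓝 (0 : ℝ), fderiv ℝ (Φ.step (partialSum F j h) h) x =
      (fderiv ℝ (numFlow Φ F j) (h, x)).comp (ContinuousLinearMap.inr ℝ ℝ (PhaseSpace n)) := by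
  filter_upwards [(tendsto_mk_nhds_zero x).eventually
    ((germSmooth_numFlow (Φ := Φ) hF j).eventually_differentiableAt x)] with h hh
  exact (hasFDerivAt_slice hh).fderiv

/-- The numerical solution of the inverse modified equation is as symplectic as the exact flow
which it approximates. -/
lemma Expands.isBigO_formDefect {j : ℕ} (hE : Expands Φ f F j) (hf : ContDiff ℝ ∞ f)
    (hF : ∀ k, ContDiff ℝ ∞ (F k)) (hfω : ∀ x u v, lieForm f x u v = 0) (x u v : PhaseSpace n) :
    (fun h => formDefect (fderiv ℝ (Φ.step (partialSum F j h) h) x) u v)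
      =O[𝓝 0] fun h => h ^ (j + 1) := by
  have h1 := flat_pullback_sub (symplecticForm n) (germSmooth_numFlow hF j) hf
    (hE.transport hf hF) (numFlow_zero_left hF j) hfω
  refine (h1.isBigO (x, (u, v))).congr' ?_ EventuallyEq.rfl
  filter_upwards [eventually_fderiv_numFlow (Φ := Φ) hF j x] with h hh
  simp [formDefect, hh]

/-- Every integrator preserves the symplectic form to order one along a Hamiltonian system. -/
lemma preservesForm_one (Φ : Integrator n) (hf : ContDiff ℝ ∞ f)
    (hfω : ∀ x u v, lieForm f x u v = 0) : PreservesForm Φ f 1 := by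
  obtain ⟨F, hF, hE⟩ := exists_expands Φ hf
  have e1 : ∀ h, partialSum F 1 h = f := fun h => by
    funext y; simp [partialSum, (hE 1).zero_eq hf hF]
  refine preservesForm_iff.2 fun x i j => ?_
  simpa only [e1] using (hE 1).isBigO_formDefect hf hF hfω x _ _

/-- If the vector fields `∑ k < j, p ^ k F k` are integrated with an error of order `h ^ (j + 1)` in
the symplectic form, then the coefficient of this error at `p = h` is the one at `p = 0`. -/
lemma isBigO_formDefect_sub {j : ℕ} (hF : ∀ k, ContDiff ℝ ∞ (F k))
    {x u v : PhaseSpace n}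
    (h : ∀ p z, (fun h => formDefect (fderiv ℝ (Φ.step (partialSum F j p) h) z) u v)
      =O[𝓝 0] fun h => h ^ (j + 1)) :
    (fun h => formDefect (fderiv ℝ (Φ.step (partialSum F j h) h) x) u v -
      formDefect (fderiv ℝ (Φ.step (partialSum F j 0) h) x) u v)
      =O[𝓝 0] fun h => h ^ (j + 2) := by
  have hS := Φ.germSmooth_family (contDiff_partialSum hF j)
  set S : ℝ × (ℝ × PhaseSpace n) → PhaseSpace n := fun q =>
    Φ.step (partialSum F j q.2.1) q.1 q.2.2
  have hd : ∀ q, DifferentiableAt ℝ S q → ∀ w,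
      fderiv ℝ (Φ.step (partialSum F j q.2.1) q.1) q.2.2 w = fderiv ℝ S q (0, (0, w)) := by
    intro q hq w
    have h1 := HasFDerivAt.comp q.2.2 (g := S) (f := fun z => (q.1, (q.2.1, z)))
      hq.hasFDerivAt ((hasFDerivAt_const q.1 q.2.2).prodMk
        ((hasFDerivAt_const q.2.1 q.2.2).prodMk (hasFDerivAt_id q.2.2)))
    exact congrArg (fun L => L w) h1.fderiv
  have hN : GermSmooth fun q : ℝ × (ℝ × PhaseSpace n) =>
      symplecticForm n (fderiv ℝ S q (0, (0, u))) (fderiv ℝ S q (0, (0, v))) -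
        symplecticForm n u v := fun z =>
    ((symplecticForm n).isBoundedBilinearMap.contDiff.contDiffAt.comp ((0 : ℝ), z)
      (((hS.fderiv z).clm_apply contDiffAt_const).prodMk
        ((hS.fderiv z).clm_apply contDiffAt_const))).sub contDiffAt_const
  have hflat : Flat (j + 1) fun q : ℝ × (ℝ × PhaseSpace n) =>
      symplecticForm n (fderiv ℝ S q (0, (0, u))) (fderiv ℝ S q (0, (0, v))) -
        symplecticForm n u v := by
    refine Flat.of_isBigO hN ?_
    rintro ⟨p, z⟩
    refine (h p z).congr' ?_ EventuallyEq.rfl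
    filter_upwards [(tendsto_mk_nhds_zero (p, z)).eventually
      (hS.eventually_differentiableAt (p, z))] with t ht
    simp only [formDefect, hd _ ht]
  have h1 := hflat.isBigO_sub_param hN (a := id) (b := fun _ => x) (x := x) tendsto_id
    tendsto_const_nhds
  simp only [id, ← pow_succ] at h1
  refine h1.congr' ?_ EventuallyEq.rfl
  have hb : Tendsto (fun h : ℝ => (h, (h, x))) (𝓝 0) (𝓝 (0, (0, x))) :=
    tendsto_id.prodMk_nhds (tendsto_mk_nhds_zero x)
  filter_upwards [(tendsto_mk_nhds_zero (0, x)).eventually (hS.eventually_differentiableAt (0, x)),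
    hb.eventually (hS.eventually_differentiableAt (0, x))] with t h0 ht
  rw [formDefect, formDefect, hd _ h0, hd _ h0, hd _ ht, hd _ ht]

lemma fderiv_numFlow_zero (hF : ∀ k, ContDiff ℝ ∞ (F k)) (j : ℕ) (x w : PhaseSpace n) :
    fderiv ℝ (numFlow Φ F j) (0, x) (0, w) = w := by
  have h1 := hasFDerivAt_slice
    ((germSmooth_numFlow (Φ := Φ) hF j).eventually_differentiableAt x).self_of_nhds
  simp only [numFlow_zero_left hF] at h1
  exact congrArg (fun L => L w) (h1.unique (hasFDerivAt_id x))

/-- Leaving out the term `h ^ j F j` of the inverse modified vector field leaves the error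
`- h ^ (j + 1) L_{F j} ω` in the symplectic form. -/
lemma isBigO_formDefect_add_lieForm {j : ℕ} (hE : Expands Φ f F (j + 1)) (hf : ContDiff ℝ ∞ f)
    (hF : ∀ k, ContDiff ℝ ∞ (F k)) (hfω : ∀ x u v, lieForm f x u v = 0) (x u v : PhaseSpace n) :
    (fun h => formDefect (fderiv ℝ (Φ.step (partialSum F j h) h) x) u v +
      h ^ (j + 1) * lieForm (F j) x u v) =O[𝓝 0] fun h => h ^ (j + 2) := by
  have hj := germSmooth_numFlow (Φ := Φ) hF j
  have hj1 := germSmooth_numFlow (Φ := Φ) hF (j + 1)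
  have hpow : GermSmooth fun q : ℝ × PhaseSpace n => q.1 ^ (j + 1) • F j q.2 := .pow_smul _ (hF j)
  let a : PhaseSpace n → ℝ → PhaseSpace n := fun w h =>
    fderiv ℝ (numFlow Φ F (j + 1)) (h, x) (0, w)
  let b : PhaseSpace n → ℝ → PhaseSpace n := fun w h =>
    fderiv ℝ (numFlow Φ F j) (h, x) (0, w)
  have ha1 : ∀ w, a w =O[𝓝 0] fun h => h ^ 0 := fun w =>
    (hj1.dx (w := fun _ => w) contDiff_const).isBigO_one x
  have hb1 : ∀ w, b w =O[𝓝 0] fun h => h ^ 0 := fun w =>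
    (hj.dx (w := fun _ => w) contDiff_const).isBigO_one x
  have hid : ∀ i w, (fun h => fderiv ℝ (numFlow Φ F i) (h, x) (0, w) - w)
      =O[𝓝 0] fun h => h ^ 1 := fun i w => by
    have hs : GermSmooth fun q => dx (fun _ => w) (numFlow Φ F i) q - w :=
      ((germSmooth_numFlow hF i).dx contDiff_const).sub (.of_contDiff contDiff_const)
    exact (Vanishes.flat (m := 1)
      ⟨fun z => by simp [dx, fderiv_numFlow_zero hF], trivial⟩ hs).isBigO x
  have hr : ∀ w, (fun h => b w h - a w h + h ^ (j + 1) • fderiv ℝ (F j) x w)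
      =O[𝓝 0] fun h => h ^ (j + 2) := fun w => by
    have h1 := ((flat_numFlow_succ Φ hF j).dx ((hj1.sub hj).sub hpow)
      (w := fun _ => w) contDiff_const).isBigO x
    refine h1.neg_left.congr' ?_ EventuallyEq.rfl
    filter_upwards [(tendsto_mk_nhds_zero x).eventually (hj.eventually_differentiableAt x),
      (tendsto_mk_nhds_zero x).eventually (hj1.eventually_differentiableAt x)] with t h2 h3
    have h4 := differentiableAt_pow_smul (j + 1) (hF j) (t, x)
    have h5 : dx (fun _ => w) (fun q : ℝ × PhaseSpace n => q.1 ^ (j + 1) • F j q.2) (t, x) = _ :=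
      dx_eq h4 (((hF j).differentiable (by simp) x).hasFDerivAt.fun_const_smul (t ^ (j + 1)))
    rw [dx_sub (h3.fun_sub h2) h4, dx_sub h3 h2, h5]
    simp only [dx, a, b, smul_apply]
    abel
  have hp : ∀ w : PhaseSpace n, (fun h : ℝ => h ^ (j + 1) • w) =O[𝓝 0] fun h => h ^ (j + 1) :=
    fun w => by
      simpa using (isBigO_refl (fun h : ℝ => h ^ (j + 1)) (𝓝 0)).smul
        (isBigO_const_const w (one_ne_zero (α := ℝ)) (𝓝 0))
  -- With `b = a - h ^ (j + 1) F j' + r`, the difference of `ω (b u) (b v)` and `ω (a u) (a v)` is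
  -- split so that each term has a factor `r`, or a factor `h ^ (j + 1)` and one of `a - id` and
  -- `b - id`.
  have k1 := isBigO_bilinear (symplecticForm n) (hr u) (hb1 v)
  have k2 := isBigO_bilinear (symplecticForm n) (ha1 u) (hr v)
  have k3 := isBigO_bilinear (symplecticForm n) (hp (fderiv ℝ (F j) x u)) (hid j v)
  have k4 := isBigO_bilinear (symplecticForm n) (hid (j + 1) u) (hp (fderiv ℝ (F j) x v))
  have k5 := hE.isBigO_formDefect hf hF hfω x u v
  rw [add_zero] at k1
  rw [zero_add] at k2
  rw [add_comm 1] at k4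
  refine ((((k1.add k2).sub k3).sub k4).add k5).congr' ?_ EventuallyEq.rfl
  filter_upwards [eventually_fderiv_numFlow (Φ := Φ) hF j x,
    eventually_fderiv_numFlow (Φ := Φ) hF (j + 1) x] with t h2 h3
  simp only [formDefect, h2, h3, lieForm, a, b, map_add, map_sub, map_smul, add_apply, sub_apply,
    smul_apply, smul_eq_mul, ContinuousLinearMap.comp_apply, ContinuousLinearMap.inr_apply]
  ring

/-- If the fields `∑ k < j, p ^ k F k` are integrated symplectically to order `j`, then the
symplectic form is preserved to order `j + 1` along `f` if and only if `F j` leaves it invariant. -/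
lemma preservesForm_succ_iff {j : ℕ} (hj : 0 < j) (hE : ∀ i, Expands Φ f F i)
    (hf : ContDiff ℝ ∞ f) (hF : ∀ k, ContDiff ℝ ∞ (F k)) (hfω : ∀ x u v, lieForm f x u v = 0)
    (hP : ∀ p, PreservesForm Φ (partialSum F j p) j) :
    PreservesForm Φ f (j + 1) ↔ ∀ x u v, lieForm (F j) x u v = 0 := by
  -- As `0 ^ 0 = 1` and `0 < j`, only the term `F 0 = f` is left at `p = 0`.
  have e0 : partialSum F j 0 = f := by
    obtain ⟨i, rfl⟩ := Nat.exists_eq_succ_of_ne_zero hj.ne'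
    funext y
    simp [partialSum, Finset.sum_range_succ', (hE 1).zero_eq hf hF]
  have key : ∀ x a b, (fun h => formDefect (fderiv ℝ (Φ.step f h) x) (EuclideanSpace.single a 1)
      (EuclideanSpace.single b 1) + h ^ (j + 1) * lieForm (F j) x (EuclideanSpace.single a 1)
      (EuclideanSpace.single b 1)) =O[𝓝 0] fun h => h ^ (j + 2) := fun x a b => by
    have h1 := isBigO_formDefect_sub hF (x := x) fun p z => preservesForm_iff.1 (hP p) z a b
    rw [e0] at h1
    refine ((isBigO_formDefect_add_lieForm (hE (j + 1)) hf hF hfω x _ _).sub h1).congr_left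
      fun h => by ring
  rw [preservesForm_iff]
  constructor
  · intro h x
    refine lieForm_eq_zero_of_single fun a b => ?_
    refine eq_zero_of_pow_smul_isBigO (m := j + 1) (((key x a b).sub (h x a b)).congr_left
      fun t => ?_)
    simp
  · intro h x a b
    simpa [h] using key x a b

/-- As long as the integrator is symplectic to order `j`, the first `j` coefficients of the inverse
modified equation of a Hamiltonian system are Hamiltonian. -/
lemma lieForm_coeff_eq_zero {j : ℕ} (hE : ∀ i, Expands Φ f F i)
    (hf : ContDiff ℝ ∞ f) (hF : ∀ k, ContDiff ℝ ∞ (F k)) (hfω : ∀ x u v, lieForm f x u v = 0)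
    (hP : ∀ H : PhaseSpace n → ℝ, ContDiff ℝ ∞ H → PreservesForm Φ (hamiltonianField H) j) :
    ∀ k < j, ∀ x u v, lieForm (F k) x u v = 0 := by
  have hP' : ∀ g : PhaseSpace n → PhaseSpace n, ContDiff ℝ ∞ g → (∀ x u v, lieForm g x u v = 0) →
      PreservesForm Φ g j := fun g hg hgω => by
    obtain ⟨H, hH, rfl⟩ := exists_hamiltonian hg hgω
    exact hP H hH
  intro k
  induction k using Nat.strong_induction_on with
  | _ k ih =>
    intro hk
    rcases Nat.eq_zero_or_pos k with rfl | hk0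
    · rwa [(hE 1).zero_eq hf hF]
    · refine (preservesForm_succ_iff hk0 hE hf hF hfω fun p => ?_).1 ((hP' f hf hfω).mono hk)
      refine (hP' _ (contDiff_partialSum_slice hF k p) fun x u v => ?_).mono hk.le
      rw [lieForm_partialSum hF]
      refine Finset.sum_eq_zero fun i hi => ?_
      have hi' := Finset.mem_range.1 hi
      rw [ih i hi' (hi'.trans hk), mul_zero]

lemma exists_order_of_not_isSymplectic (h : ¬ IsSymplectic Φ) : ∃ k, 0 < k ∧
    (∀ H : PhaseSpace n → ℝ, ContDiff ℝ ∞ H → PreservesForm Φ (hamiltonianField H) k) ∧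
    ∃ H : PhaseSpace n → ℝ, ContDiff ℝ ∞ H ∧ ¬ PreservesForm Φ (hamiltonianField H) (k + 1) := by
  classical
  have h1 : ∃ r, ∃ H : PhaseSpace n → ℝ, ContDiff ℝ ∞ H ∧
      ¬ PreservesForm Φ (hamiltonianField H) r := by
    simp only [IsSymplectic, not_forall] at h
    obtain ⟨H, hH, r, hr⟩ := h
    exact ⟨r, H, hH, hr⟩
  obtain ⟨H, hH, hr⟩ := Nat.find_spec h1
  have h2 : 1 < Nat.find h1 := by
    by_contra hle
    exact hr ((preservesForm_one Φ (contDiff_hamiltonianField hH)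
      (lieForm_hamiltonianField hH)).mono (not_lt.1 hle))
  obtain ⟨k, hk⟩ := Nat.exists_eq_succ_of_ne_zero (by omega : Nat.find h1 ≠ 0)
  refine ⟨k, by omega, fun G hG => ?_, H, hH, by rwa [hk] at hr⟩
  by_contra hG'
  exact Nat.find_min h1 (m := k) (by omega) ⟨G, hG, hG'⟩

/-- The lowest coefficient that does not leave the symplectic form invariant dominates for small
`h`. -/
lemma eventually_lieForm_truncation_ne_zero (hF : ∀ k, ContDiff ℝ ∞ (F k)) {k K : ℕ} (hK : k ≤ K)
    {x u v : PhaseSpace n} (h0 : ∀ i < k, lieForm (F i) x u v = 0)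
    (hk : lieForm (F k) x u v ≠ 0) :
    ∀ᶠ h in 𝓝[≠] (0 : ℝ), lieForm (truncation F K h) x u v ≠ 0 := by
  obtain ⟨m, rfl⟩ := Nat.exists_eq_add_of_le hK
  have hc : Continuous fun h : ℝ =>
      ∑ i ∈ Finset.range (m + 1), h ^ i * lieForm (F (k + i)) x u v := by fun_prop
  have h1 := hc.continuousAt.eventually_ne (x := 0) (y := 0)
    (by simpa [Finset.sum_range_succ'] using hk)
  filter_upwards [h1.filter_mono nhdsWithin_le_nhds, self_mem_nhdsWithin] with h hh hne
  have h2 : lieForm (truncation F (k + m) h) x u v = h ^ k *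
      ∑ i ∈ Finset.range (m + 1), h ^ i * lieForm (F (k + i)) x u v := by
    refine (lieForm_partialSum hF (k + m + 1) h x u v).trans ?_
    rw [add_assoc, Finset.sum_range_add, Finset.sum_eq_zero, zero_add, Finset.mul_sum]
    · exact Finset.sum_congr rfl fun i _ => by ring
    · exact fun i hi => by rw [h0 i (Finset.mem_range.1 hi), mul_zero]
  rw [h2]
  exact mul_ne_zero (pow_ne_zero k hne) hh

end SymplecticOrder

end

end IMDE

theorem lemma3p4 (n : ℕ) (Φ : IMDE.Integrator n) :
    -- the inverse modified differential equation exists and is unique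
    (∀ f : IMDE.PhaseSpace n → IMDE.PhaseSpace n, ContDiff ℝ ∞ f →
      ∃! F : ℕ → IMDE.PhaseSpace n → IMDE.PhaseSpace n, IMDE.IsIMDE Φ f F) ∧
    -- symplectic integrators
    (IMDE.IsSymplectic Φ →
      ∀ H : IMDE.PhaseSpace n → ℝ, ContDiff ℝ ∞ H →
      ∀ F : ℕ → IMDE.PhaseSpace n → IMDE.PhaseSpace n,
      IMDE.IsIMDE Φ (IMDE.hamiltonianField H) F →
      ∀ x, ∃ U : Set (IMDE.PhaseSpace n), IsOpen U ∧ x ∈ U ∧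
        ∃ G : ℕ → IMDE.PhaseSpace n → ℝ, ∀ k, ContDiffOn ℝ ∞ (G k) U ∧
          ∀ y ∈ U, F k y = IMDE.hamiltonianField (G k) y) ∧
    -- integrators that are not symplectic; `k` is the order to which `Φ` preserves the form
    (¬ IMDE.IsSymplectic Φ →
      ∃ k : ℕ,
        (∀ H : IMDE.PhaseSpace n → ℝ, ContDiff ℝ ∞ H →
          IMDE.PreservesForm Φ (IMDE.hamiltonianField H) k) ∧
        (∃ H : IMDE.PhaseSpace n → ℝ, ContDiff ℝ ∞ H ∧
          ¬ IMDE.PreservesForm Φ (IMDE.hamiltonianField H) (k + 1)) ∧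
        ∀ H : IMDE.PhaseSpace n → ℝ, ContDiff ℝ ∞ H →
          ¬ IMDE.PreservesForm Φ (IMDE.hamiltonianField H) (k + 1) →
          ∀ F : ℕ → IMDE.PhaseSpace n → IMDE.PhaseSpace n,
          IMDE.IsIMDE Φ (IMDE.hamiltonianField H) F →
            ¬ IMDE.IsLocallyPotential (fun y => IMDE.act (IMDE.J n) (F k y)) ∧
            ∀ K, k ≤ K → ∀ᶠ h in 𝓝[≠] (0 : ℝ),
              ¬ IMDE.IsLocallyPotential
                (fun y => IMDE.act (IMDE.J n) (IMDE.truncation F K h y))) := by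
  refine ⟨fun f hf => IMDE.existsUnique_isIMDE Φ hf, fun hΦ H hH F hF x => ?_, fun hΦ => ?_⟩
  · have hf := IMDE.contDiff_hamiltonianField hH
    obtain ⟨hFs, hE⟩ := (IMDE.isIMDE_iff hf).1 hF
    have h1 : ∀ k, ∃ G : IMDE.PhaseSpace n → ℝ,
        ContDiff ℝ ∞ G ∧ IMDE.hamiltonianField G = F k := fun k =>
      IMDE.exists_hamiltonian (hFs k) (IMDE.lieForm_coeff_eq_zero hE hf hFs
        (IMDE.lieForm_hamiltonianField hH) (fun G hG => hΦ G hG (k + 1)) k k.lt_succ_self)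
    choose G hG hGF using h1
    exact ⟨Set.univ, isOpen_univ, trivial, G, fun k =>
      ⟨(hG k).contDiffOn, fun y _ => (congrFun (hGF k) y).symm⟩⟩
  · obtain ⟨k, hk, hP, hN⟩ := IMDE.exists_order_of_not_isSymplectic hΦ
    refine ⟨k, hP, hN, fun H hH hHN F hF => ?_⟩
    have hf := IMDE.contDiff_hamiltonianField hH
    have hfω := IMDE.lieForm_hamiltonianField hH
    obtain ⟨hFs, hE⟩ := (IMDE.isIMDE_iff hf).1 hF
    have h0 := IMDE.lieForm_coeff_eq_zero hE hf hFs hfω hP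
    have hPk : ∀ p, IMDE.PreservesForm Φ (IMDE.partialSum F k p) k := fun p => by
      obtain ⟨G, hG, hGp⟩ := IMDE.exists_hamiltonian (IMDE.contDiff_partialSum_slice hFs k p)
        fun x u v => by
          rw [IMDE.lieForm_partialSum hFs]
          exact Finset.sum_eq_zero fun i hi => by rw [h0 i (Finset.mem_range.1 hi), mul_zero]
      exact hGp ▸ hP G hG
    rw [IMDE.preservesForm_succ_iff hk hE hf hFs hfω hPk] at hHN
    push Not at hHN
    obtain ⟨x, u, v, hne⟩ := hHN
    refine ⟨fun hL => hne (IMDE.lieForm_eq_zero_of_isLocallyPotential (hFs k) hL x u v),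
      fun K hK => ?_⟩
    filter_upwards [IMDE.eventually_lieForm_truncation_ne_zero hFs hK
      (fun i hi => h0 i hi x u v) hne] with h hh hL
    exact hh (IMDE.lieForm_eq_zero_of_isLocallyPotential
      (IMDE.contDiff_partialSum_slice hFs (K + 1) h) hL x u v)
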